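/- Let $\mathrm{Rot}\,\mathbb{E}^2=\mathbb{C}\times U(1)$ be the quandle with $(z,e^{i\theta})*(w,e^{i\eta})=((z-w)e^{i\eta}+w,\,e^{i\theta})$. Let $p,q$ be coprime integers with $|p|,|q|\ge 2$, and let $1\le k\le |p|-1$, $1\le l\le |q|-1$. Let $D(p,q)$ be the standard diagram of the $(p,q)$-torus knot as the closure of the $|p|$-strand braid consisting of $|q|$ equal blocks, with arcs $a_{ij}$ ($0\le i\le|q|-1$, $0\le j\le|p|-1$), such that in the $i$-th block the arc $a_{i0}=a_{i+1,|p|-1}$ passes over the strands $a_{i1},\dots,a_{i,|p|-1}$, the strand $a_{i,j+1}$ on the right of $a_{i0}$ continuing as $a_{i+1,j}$ on its left (first indices modulo $|q|$). For $m\ge2$, a regular polygon of type $(m,k)$ has as its vertices, in order, every $k$-th vertex of a convex regular $m$-gon in $\mathbb{C}$ listed counterclockwise, indexed modulo $m$. Let $Q$ be a regular polygon of type $(|q|,l)$ with vertices $v^Q_0,v^Q_1,\dots$ and side length $1$, and let $P_0$ be one of type $(|p|,k)$ with vertices $w_{00},w_{01},\dots$, where $w_{00}=v^Q_0$ and $w_{01}=v^Q_1$.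 Put $$\theta=\Bigl(\tfrac{|p|-2k}{|p|}-\tfrac{|q|-2l}{|q|}\Bigr)\pi,$$ and let $P_i$, with vertices $w_{i0},w_{i1},\dots$, be the image of $P_{i-1}$ under the rotation about $v^Q_i$ by the angle $\theta$. Let $\mathscr{C}_0$ be the $\mathrm{Rot}\,\mathbb{E}^2$-coloring of $D(p,q)$ given by $\mathscr{C}_0(a_{ij})=(w_{i,i+j+1},e^{i\theta})$. Let $\mathscr{W}_3\subset\mathbb{C}$ be the set of all points that occur as the first component of the color of an arc in some colored diagram obtained from $(D(p,q),\mathscr{C}_0)$ by a finite sequence of Reidemeister moves and planar isotopies. Put $p'=|p|/\gcd(|p|,k)$ and $q'=|q|/\gcd(|q|,l)$, let $\alpha=p'q'/2$ if $p'q'$ is even and $\alpha=p'q'$ otherwise, and for $0\le\sigma\le2\alpha-1$ let $$v_\sigma=\cos\Bigl(\arg(w_{01}-w_{00})+\tfrac{\sigma\pi}{\alpha}\Bigr)+\sqrt{-1}\,\sin\Bigl(\arg(w_{01}-w_{00})+\tfrac{\sigma\pi}{\alpha}\Bigr).$$ Then for each $w\in\mathscr{W}_3$ there are exactly $2\alpha$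 points of $\mathscr{W}_3$ on the unit circle centered at $w$, and these are the points $w+v_\sigma$ ($0\le\sigma\le2\alpha-1$). -/

import Mathlib

open scoped Quandles

/-! ### The quandle of rotations of the plane -/

/-- A rotational transformation of the plane `ℂ`: the centre and the rotation factor `e^{iθ}`. -/
@[ext]
structure RotE2 where
  center : ℂ
  factor : Circle

/-- In Mathlib the acting element of a quandle is on the left: `y ◃ x` is what is often written
`x * y`.  Here `y ◃ x` is obtained from `x` by rotating the centre of `x` by the rotation `y`. -/
noncomputable instance : Quandle RotE2 where
  act y x := ⟨(x.center - y.center) * (y.factor : ℂ) + y.center, x.factor⟩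
  self_distrib := by
    intro x y z
    ext <;> simp
    ring
  invAct y x := ⟨(x.center - y.center) * ((y.factor : ℂ))⁻¹ + y.center, x.factor⟩
  left_inv := by
    intro y x
    ext <;> simp
  right_inv := by
    intro y x
    ext <;> simp
  fix := by
    intro x
    ext <;> simp

/-! ### Oriented diagrams up to planar isotopy -/

/-- An oriented diagram with over/under information, with at least one crossing, recorded up to
isotopy by a signed Gauss code with a marked face.

* `(x, true)` and `(x, false)` denote the over-strand and the under-strand through the crossing `x`.
  An element `(x, s)` also names the edge (a piece of the diagram between two consecutive
  crossings) which leaves `x` along that strand.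
* `next (x, s)` is the strand-at-a-crossing which that edge enters.
* `pos x` says whether the crossing is positive: the direction of the under-strand is obtained
  from that of the over-strand by a counterclockwise quarter turn.  At a negative crossing it is
  a clockwise quarter turn.
* A side `(e, true)` is the left-hand side of the edge `e`, and `(e, false)` is its right-hand side.
  `outer` is a side lying on the unbounded face of the plane.

The code determines its cyclic order at every crossing and thus a cellular embedding in a closed
oriented surface, with the faces described by `faceNext` below.  The moves below are performed inside
discs of this surface and change neither the surface nor the number of components, so all diagrams
obtained by them from a knot diagram in the plane are knot diagrams in the plane.
A nontrivial knot has no diagram without crossings, so nothing is lost by leaving these out. -/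
structure Diagram where
  Crossing : Type
  finite : Finite Crossing
  pos : Crossing → Bool
  next : Equiv.Perm (Crossing × Bool)
  outer : (Crossing × Bool) × Bool

namespace Diagram

/-- Strands at crossings, or the edges leaving the crossings along them. -/
abbrev Edge (D : Diagram) : Type := D.Crossing × Bool

/-- Sides of edges; `true` is left and `false` is right. -/
abbrev Side (D : Diagram) : Type := D.Edge × Bool

/-- Walk along an edge with the given side on one's left hand (thus forwards for the left side and
backwards for the right side), take the sharpest left turn at the crossing one arrives at, and
return the side of the new edge that is now on the left hand. -/
def faceNext (D : Diagram) : D.Side → D.Side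
  | (e, true) =>
      let y := (D.next e).1
      let s := (D.next e).2
      if s = D.pos y then ((y, !s), true) else (D.next.symm (y, !s), false)
  | ((x, s), false) =>
      if s = D.pos x then (D.next.symm (x, !s), false) else ((x, !s), true)

/-- Two sides belong to the same face of the diagram. -/
def SameFace (D : Diagram) : D.Side → D.Side → Prop :=
  Relation.EqvGen fun d d' => D.faceNext d = d'

/-- Colorings by a quandle.  A coloring of the arcs is the same as a coloring of the edges in which
the two edges forming an over-strand have the same color.  At each crossing with over-color `y`, the
under-edge on the right of the over-strand has some color `x` and the one on its left has
color `x * y` (that is `y ◃ x` in Mathlib's notation). -/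
def IsColoring {X : Type*} [Quandle X] (D : Diagram) (C : D.Edge → X) : Prop :=
  ∀ x : D.Crossing,
    C (D.next.symm (x, true)) = C (x, true) ∧
    (D.pos x = true → C (x, false) = C (x, true) ◃ C (D.next.symm (x, false))) ∧
    (D.pos x = false → C (D.next.symm (x, false)) = C (x, true) ◃ C (x, false))

/-- Suppose that the crossings of `D` are regarded as some of the crossings of `D'` through `ι`.
`Segment D D' ι e e'` says that the edge `e'` of `D'` is a part of the edge `e` of `D`: it is reached
from the tail of `e` by passing only through crossings outside the range of `ι`. -/
inductive Segment (D D' : Diagram) (ι : D.Crossing → D'.Crossing) : D.Edge → D'.Edge → Prop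
  | start (e : D.Edge) : Segment D D' ι e (ι e.1, e.2)
  | cont {e : D.Edge} {e' : D'.Edge} : Segment D D' ι e e' →
      (D'.next e').1 ∉ Set.range ι → Segment D D' ι e (D'.next e')

/-- `D` is obtained from `D'` by erasing the crossings outside the range of `ι` from the
signed Gauss code; no component is erased entirely. -/
structure Erasure (D D' : Diagram) (ι : D.Crossing → D'.Crossing) : Prop where
  inj : Function.Injective ι
  pos_eq : ∀ x, D'.pos (ι x) = D.pos x
  next_eq : ∀ e e' f, Segment D D' ι e e' → D'.next e' = (ι f.1, f.2) → D.next e = f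
  covers : ∀ e', ∃ e, Segment D D' ι e e'

open Classical in
/-- In a triangle formed by three strands meeting at the crossings `x`, `y` and `z`, where the top
strand passes over `x` and `y`, the middle one under `x` and over `z`, and the bottom one under `y`
and `z`, exchange the two crossings on each of the three strands. -/
noncomputable def triangleSwap {K : Type} (x y z : K) : Equiv.Perm (K × Bool) :=
  Equiv.swap (x, true) (y, true) * Equiv.swap (x, false) (z, true) *
    Equiv.swap (y, false) (z, false)

/-- `Move D D' ρ` says that `D` and `D'` are related by a planar isotopy, by a Reidemeister move
RI or RII that takes `D'` to `D` by removing one or two crossings, or by a Reidemeister move RIII.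
`ρ e e'` says that the edges `e` of `D` and `e'` of `D'` have a piece in common that
lies outside the disc in which the move takes place. -/
inductive Move (D D' : Diagram) : (D.Edge → D'.Edge → Prop) → Prop
  /-- The two diagrams are isomorphic. -/
  | isotopy (φ : D.Crossing ≃ D'.Crossing)
      (hpos : ∀ x, D'.pos (φ x) = D.pos x)
      (hnext : ∀ e : D.Edge, D'.next (φ e.1, e.2) = (φ (D.next e).1, (D.next e).2)) :
      Move D D' fun e e' => e' = (φ e.1, e.2)
  /-- The crossing `c` of `D'` carries a kink, namely the loop edge `(c, s)`.
  It is removed in `D`. -/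
  | R1 (ι : D.Crossing → D'.Crossing) (c : D'.Crossing) (s : Bool)
      (herase : Erasure D D' ι) (hrange : Set.range ι = {c}ᶜ)
      (hloop : D'.next (c, s) = (c, !s)) :
      Move D D' fun e e' => Segment D D' ι e e' ∧ e' ≠ (c, s)
  /-- In `D'` there is a bigon with corners `c` and `d`, of opposite signs.  Its over-edge goes
  from `c` to `d` and its under-edge goes from `x` to `y`, where `{x, y} = {c, d}`.  Both crossings
  are removed in `D`.  The sides facing each other after the removal are on the same face of `D`, as
  the strands have been pulled apart within a disc. -/
  | R2 (ι : D.Crossing → D'.Crossing) (c d x y : D'.Crossing) (a b : D.Edge)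
      (herase : Erasure D D' ι) (hcd : c ≠ d) (hrange : Set.range ι = {c, d}ᶜ)
      (hxy : (x = c ∧ y = d) ∨ (x = d ∧ y = c))
      (hsign : D'.pos c ≠ D'.pos d)
      (hover : D'.next (c, true) = (d, true)) (hunder : D'.next (x, false) = (y, false))
      (ha : Segment D D' ι a (c, true)) (hb : Segment D D' ι b (x, false))
      (hface : D.SameFace (a, D'.pos y) (b, D'.pos c)) :
      Move D D' fun e e' => Segment D D' ι e e' ∧ e' ≠ (c, true) ∧ e' ≠ (x, false)
  /-- The edges `t`, `m`, `b` of the top, the middle and the bottom strand bound a triangular face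
  of `D`.  The two crossings on each of these strands are exchanged in `D'`. -/
  | R3 (φ : D.Crossing ≃ D'.Crossing) (x y z : D.Crossing) (t m b : D.Edge)
      (hxy : x ≠ y) (hyz : y ≠ z) (hxz : x ≠ z)
      (ht : ({t, D.next t} : Set D.Edge) = {(x, true), (y, true)})
      (hm : ({m, D.next m} : Set D.Edge) = {(x, false), (z, true)})
      (hb : ({b, D.next b} : Set D.Edge) = {(y, false), (z, false)})
      (hface : ∃ i j k : Bool,
        (D.faceNext (t, i) = (m, j) ∧ D.faceNext (m, j) = (b, k) ∧ D.faceNext (b, k) = (t, i)) ∨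
        (D.faceNext (t, i) = (b, k) ∧ D.faceNext (b, k) = (m, j) ∧ D.faceNext (m, j) = (t, i)))
      (hpos : ∀ u, D'.pos (φ u) = D.pos u)
      (hnext : ∀ e f : D.Edge, D.next e = f →
        D'.next (φ (triangleSwap x y z e).1, (triangleSwap x y z e).2) =
          (φ (triangleSwap x y z f).1, (triangleSwap x y z f).2)) :
      Move D D' fun e e' =>
        e' = (φ (triangleSwap x y z e).1, (triangleSwap x y z e).2) ∧ e ≠ t ∧ e ≠ m ∧ e ≠ b

end Diagram

/-- A diagram together with colors of its edges. -/
abbrev ColoredDiagram (X : Type*) := Σ D : Diagram, D.Edge → X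

/-- A planar isotopy or a Reidemeister move applied to a colored diagram: colors of edges outside
the disc of the move are kept, and the unbounded face of the plane remains the unbounded face
(in particular it is not the kink, the bigon or the triangle of the move). -/
def ColoredMove {X : Type*} [Quandle X] (A B : ColoredDiagram X) : Prop :=
  A.1.IsColoring A.2 ∧ B.1.IsColoring B.2 ∧
    ∃ ρ, Diagram.Move A.1 B.1 ρ ∧ (∀ e e', ρ e e' → A.2 e = B.2 e') ∧
      ∃ e e' σ, ρ e e' ∧ A.1.SameFace A.1.outer (e, σ) ∧ B.1.SameFace B.1.outer (e', σ)

/-- `B` is obtained from `A` by a finite sequence of Reidemeister moves (in either direction) and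
planar isotopies. -/
def REquiv {X : Type*} [Quandle X] : ColoredDiagram X → ColoredDiagram X → Prop :=
  Relation.EqvGen ColoredMove

/-! ### The standard diagram of a torus knot -/

/-- The strand permutation of the closure of the braid `(σ₁ ⋯ σ_{m-1})^n` with `m` strands.
Let `a_{ij}` (`0 ≤ j < m`) be the arcs between the `(i-1)`-st and the `i`-th block.
In the `i`-th block the strand of `a_{i0}` passes over `a_{i1}, …, a_{i,m-1}` in this order
and continues as `a_{i+1,m-1}`.  The crossing `(i, j)` is the one of `a_{i0}` over `a_{i,j+1}`, and the
latter strand continues as `a_{i+1,j}`.  The block index is cyclic. -/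
def torusNext (m n : ℕ) : Equiv.Perm ((Fin n × Fin (m - 1)) × Bool) where
  toFun
    | ((i, j), true) =>
        if h : j.val + 1 < m - 1 then ((i, ⟨j.val + 1, h⟩), true) else ((finRotate n i, j), false)
    | ((i, j), false) =>
        if 0 < j.val then ((finRotate n i, ⟨j.val - 1, by omega⟩), false)
        else ((finRotate n i, j), true)
  invFun
    | ((i, j), true) =>
        if 0 < j.val then ((i, ⟨j.val - 1, by omega⟩), true)
        else (((finRotate n).symm i, j), false)
    | ((i, j), false) =>
        if h : j.val + 1 < m - 1 then (((finRotate n).symm i, ⟨j.val + 1, h⟩), false)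
        else (((finRotate n).symm i, j), true)
  left_inv := by
    generalize finRotate n = r
    rintro ⟨⟨i, j⟩, _ | _⟩
    · rcases Nat.eq_zero_or_pos j.val with h | h
      · simp [h]
      · have h1 : j.val - 1 + 1 = j.val := by omega
        simp [h, h1]
    · by_cases h : j.val + 1 < m - 1 <;> simp [h]
  right_inv := by
    generalize finRotate n = r
    rintro ⟨⟨i, j⟩, _ | _⟩
    · by_cases h : j.val + 1 < m - 1 <;> simp [h]
    · rcases Nat.eq_zero_or_pos j.val with h | h
      · simp [h]
      · have h1 : j.val - 1 + 1 = j.val := by omega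
        simp [h, h1]

/-- The diagram `D(p, q)` of the `(p, q)`-torus knot: a closed braid with `|p|` strands and `|q|`
blocks.  If `pq > 0`, all crossings are positive and the knot runs through the
blocks in increasing order.  If `pq < 0`, it is the mirror image in the plane with
reversed orientation, so that all crossings are negative.  In both cases `a_{i+1,j}` is on the left
of the over-strand `a_{i0}` and `a_{i,j+1}` is on its right.  The arcs `a_{i,|p|-1}` bound the
unbounded face. -/
def torusDiagram (p q : ℤ) (hp : 2 ≤ p.natAbs) (hq : 2 ≤ q.natAbs) : Diagram where
  Crossing := Fin q.natAbs × Fin (p.natAbs - 1)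
  finite := inferInstance
  pos _ := decide (0 < p * q)
  next := if 0 < p * q then torusNext p.natAbs q.natAbs else (torusNext p.natAbs q.natAbs).symm
  outer := (((⟨0, by omega⟩, ⟨p.natAbs - 2, by omega⟩), decide (0 < p * q)), false)

/-! ### Trochoids and the colorings derived from them -/

/-- A regular polygon of type `(m, k)`, with vertices `v_j` where `v_0, v_1, …` are every
`k`-th vertex, in counterclockwise order, of a convex regular `m`-gon. -/
structure RegularPolygon (m k : ℕ) where
  center : ℂ
  radius : ℂ
  radius_ne_zero : radius ≠ 0

/-- The vertices; the index only matters modulo `m`. -/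
noncomputable def RegularPolygon.vertex {m k : ℕ} (R : RegularPolygon m k) (j : ℕ) : ℂ :=
  R.center + R.radius * Complex.exp (2 * Real.pi * Complex.I * ((j * k : ℕ) : ℂ) / m)

/-- The angle `θ(m, k; n, l)`. -/
noncomputable def trochoidAngle (m k n l : ℕ) : ℝ :=
  (((m : ℝ) - 2 * k) / m - ((n : ℝ) - 2 * l) / n) * Real.pi

/-- The `j`-th vertex `w_{ij}` of the polygon `P_i` of the `(m, k; n, l)`-trochoid around `Q`
starting at `P = P_0`: the polygon `P_{i+1}` is obtained from `P_i` by rotating it about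
the vertex `v_{i+1}` of `Q` by the angle `θ(m, k; n, l)`. -/
noncomputable def trochoid {m k n l : ℕ} (Q : RegularPolygon n l) (P : RegularPolygon m k) :
    ℕ → ℕ → ℂ
  | 0, j => P.vertex j
  | i + 1, j =>
      (trochoid Q P i j - Q.vertex (i + 1)) *
        Complex.exp (trochoidAngle m k n l * Complex.I) + Q.vertex (i + 1)

/-- The color `(w_{i,i+j+1}, e^{iθ})` of the arc `a_{ij}` in the coloring derived from a trochoid. -/
noncomputable def arcColor {m k n l : ℕ} (Q : RegularPolygon n l) (P : RegularPolygon m k)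
    (i : Fin n) (j : ℕ) : RotE2 :=
  ⟨trochoid Q P i.val (i.val + j + 1), Circle.exp (trochoidAngle m k n l)⟩

/-- The coloring of `D(p, q)` derived from the trochoid around `Q` starting at `P`.
An edge leaving the crossing `(i, j)` along the over-strand belongs to the arc `a_{i0}`.
The one leaving along the under-strand belongs to `a_{i+1,j}` if `pq > 0`, and to
`a_{i,j+1}` if `pq < 0`. -/
noncomputable def trochoidColoring (p q : ℤ) (hp : 2 ≤ p.natAbs) (hq : 2 ≤ q.natAbs) {k l : ℕ}
    (Q : RegularPolygon q.natAbs l) (P : RegularPolygon p.natAbs k) :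
    (torusDiagram p q hp hq).Edge → RotE2 :=
  fun e : (Fin q.natAbs × Fin (p.natAbs - 1)) × Bool =>
    match e with
    | ((i, _), true) => arcColor Q P i 0
    | ((i, j), false) =>
        if 0 < p * q then arcColor Q P (finRotate q.natAbs i) j.val
        else arcColor Q P i (j.val + 1)

/-- The set `𝒲₃` of the points used as the first component of a color of an arc by some colored
diagram obtained from the coloring of `D(p, q)` derived from the trochoid around `Q`
starting at `P`. -/
def reachablePoints (p q : ℤ) (hp : 2 ≤ p.natAbs) (hq : 2 ≤ q.natAbs) {k l : ℕ}
    (Q : RegularPolygon q.natAbs l) (P : RegularPolygon p.natAbs k) : Set ℂ :=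
  {w | ∃ (D : Diagram) (C : D.Edge → RotE2),
    REquiv ⟨torusDiagram p q hp hq, trochoidColoring p q hp hq Q P⟩ ⟨D, C⟩ ∧
      ∃ e, (C e).center = w}

/-- With `p' = |p| / gcd(|p|, k)` and `q' = |q| / gcd(|q|, l)`, the number `α` is `p'q'/2` if `p'q'` is
even and `p'q'` otherwise. -/
def alphaNumber (p q : ℤ) (k l : ℕ) : ℕ :=
  let p' := p.natAbs / p.natAbs.gcd k
  let q' := q.natAbs / q.natAbs.gcd l
  if Even (p' * q') then p' * q' / 2 else p' * q'

/-- The unit vector `v_σ` with argument `arg (w₀₁ - w₀₀) + σπ/α`. -/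
noncomputable def unitVector (w₀₀ w₀₁ : ℂ) (α σ : ℕ) : ℂ :=
  (Real.cos (Complex.arg (w₀₁ - w₀₀) + σ * Real.pi / α) : ℂ) +
    Complex.I * (Real.sin (Complex.arg (w₀₁ - w₀₀) + σ * Real.pi / α) : ℂ)

/-! Write ζ = e^{iθ} and u = w₀₁ - w₀₀. Everything rests on `reachablePoints_eq`: the reachable
points are exactly w₀₀ + u·ℤ[ζ]. As |u| = 1, the points at distance 1 from a given one correspond to
the elements of ℤ[ζ] of absolute value 1. By Kronecker's theorem these are the roots of unity in
ℤ[ζ] (`IsPrimitiveRoot.pow_eq_one_of_norm_eq_one`). Since ζ has order N = p'q', there are N of them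
if N is even and 2N if N is odd, which is 2α.

No more points occur: the colors inside the disc of a move lie in the subquandle generated by the
colors outside, so a subquandle that contains all colors keeps doing so (`REquiv.mem_iff`). The
rotations by ζ about the points of w₀₀ + u·ℤ[ζ] form such a subquandle.

All these points occur: by RII moves, a finger of a strand of color c can be pushed through
successive faces until it covers an edge of color x, which creates the color c ◃ x and keeps every
over-color available (`Diagram.exists_act_color`). So the reachable set is stable under rotation by
ζ about w₀₀ and w₀₁. The two rotations combine to the translation by u(1 - ζ), and conjugation turns
this into a ℤ[ζ]-module of translations. As N is a product of two coprime numbers ≥ 2, it is not a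
prime power, so Φ_N(1) = 1, 1 - ζ is a unit, and all translations by u·ℤ[ζ] arise
(`IsPrimitiveRoot.adjoin_subset_of_rotations`). -/

namespace Diagram

/-- Every set of crossings that is closed under passing to neighbouring crossings is trivial. -/
def Connected (D : Diagram) : Prop :=
  ∀ f : D.Crossing → Prop, (∀ e : D.Edge, f (D.next e).1 ↔ f e.1) → ∀ x y, f x ↔ f y

/-- Some edge with color `c` ends as the over-strand of a crossing other than the one at its tail. -/
def HasOver {X : Type*} (D : Diagram) (C : D.Edge → X) (c : X) : Prop :=
  ∃ (a : D.Edge) (x : D.Crossing), C a = c ∧ D.next a = (x, true) ∧ a.1 ≠ x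

/-! ### Pushing a finger of one edge over another. -/

section Finger

variable (D : Diagram) (a b : D.Edge) (τ : Bool)

/-- The first piece of an old edge after the insertion of two crossings. -/
def firstPiece (e : D.Edge) : (D.Crossing ⊕ Bool) × Bool := (Sum.inl e.1, e.2)

open Classical in
/-- The last piece of an old edge after the insertion of two crossings on `a` and on `b`. -/
noncomputable def lastPiece (e : D.Edge) : (D.Crossing ⊕ Bool) × Bool :=
  if e = a then (Sum.inr (!τ), true) else if e = b then (Sum.inr false, false)
  else D.firstPiece e

variable {D a b} in
open Classical in
/-- The strand permutation after a finger of the edge `a` has been pushed over the edge `b`. -/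
noncomputable def fingerNext (hab : a ≠ b) : Equiv.Perm ((D.Crossing ⊕ Bool) × Bool) where
  toFun
    | (.inl x, s) =>
        -- Approaching `b` from its left makes the outward crossing positive, so `a` meets the
        -- crossing of sign `τ` first. Along `b` the positive crossing comes first for both values
        -- of `τ`, because the finger leaves `a` on the right.
        if (x, s) = a then (.inr τ, true) else if (x, s) = b then (.inr true, false)
        else D.firstPiece (D.next (x, s))
    | (.inr s, true) => if s = τ then (.inr (!τ), true) else D.firstPiece (D.next a)
    | (.inr s, false) => if s = true then (.inr false, false) else D.firstPiece (D.next b)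
  invFun
    | (.inl x, s) => D.lastPiece a b τ (D.next.symm (x, s))
    | (.inr s, true) => if s = τ then D.firstPiece a else (.inr τ, true)
    | (.inr s, false) => if s = true then D.firstPiece b else (.inr true, false)
  left_inv := by
    rintro ⟨x | s, t⟩
    · by_cases h1 : (x, t) = a
      · subst h1
        simp [firstPiece]
      · by_cases h2 : (x, t) = b
        · subst h2
          simp [h1, firstPiece]
        · simp [h1, h2, firstPiece, lastPiece]
    · cases s <;> cases t <;> cases τ <;> simp [firstPiece, lastPiece, hab.symm]
  right_inv := by
    rintro ⟨x | s, t⟩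
    · by_cases h1 : D.next.symm (x, t) = a
      · subst h1
        cases τ <;> simp [lastPiece, firstPiece]
      · by_cases h2 : D.next.symm (x, t) = b
        · subst h2
          simp [lastPiece, h1, firstPiece]
        · simp [h1, h2, firstPiece, lastPiece]
    · cases s <;> cases t <;> cases τ <;> simp [firstPiece, hab.symm]

variable {D a b} in
/-- The diagram obtained by pushing a finger of `a` to its right and then over `b`, which is approached
from its side `τ`.  The new crossing `Sum.inr s` has sign `s`. -/
noncomputable abbrev finger (hab : a ≠ b) : Diagram where
  Crossing := D.Crossing ⊕ Bool
  finite := by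
    have := D.finite
    infer_instance
  pos := Sum.elim D.pos id
  next := fingerNext τ hab
  -- First pieces lie outside the disc of the move, so this marking fits the condition on unbounded
  -- faces in `ColoredMove`.
  outer := (D.firstPiece D.outer.1, D.outer.2)

end Finger

section FingerLemmas

variable {D : Diagram} {a b : D.Edge} {τ : Bool} (hab : a ≠ b)

theorem fingerNext_first_over : fingerNext τ hab (D.firstPiece a) = (Sum.inr τ, true) :=
  if_pos rfl

theorem fingerNext_first_under : fingerNext τ hab (D.firstPiece b) = (Sum.inr true, false) :=
  (if_neg hab.symm).trans (if_pos rfl)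

theorem fingerNext_tip : fingerNext τ hab (Sum.inr τ, true) = (Sum.inr (!τ), true) :=
  if_pos rfl

theorem fingerNext_mid : fingerNext τ hab (Sum.inr true, false) = (Sum.inr false, false) := by
  simp [fingerNext]

theorem fingerNext_symm_first (e : D.Edge) :
    (fingerNext τ hab).symm (D.firstPiece e) = D.lastPiece a b τ (D.next.symm e) := rfl

theorem fingerNext_last (e : D.Edge) :
    fingerNext τ hab (D.lastPiece a b τ e) = D.firstPiece (D.next e) := by
  rw [← Equiv.eq_symm_apply, fingerNext_symm_first, Equiv.symm_apply_apply]

theorem lastPiece_over : D.lastPiece a b τ a = (Sum.inr (!τ), true) := by simp [lastPiece]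

theorem lastPiece_under (hab : a ≠ b) : D.lastPiece a b τ b = (Sum.inr false, false) := by
  simp [lastPiece, hab.symm]

theorem lastPiece_of_ne {e : D.Edge} (ha : e ≠ a) (hb : e ≠ b) :
    D.lastPiece a b τ e = D.firstPiece e := by simp [lastPiece, ha, hb]

theorem fingerNext_symm_tip : (fingerNext τ hab).symm (Sum.inr τ, true) = D.firstPiece a := by
  rw [Equiv.symm_apply_eq, fingerNext_first_over]

theorem fingerNext_symm_over_end :
    (fingerNext τ hab).symm (Sum.inr (!τ), true) = (Sum.inr τ, true) := by
  rw [Equiv.symm_apply_eq, fingerNext_tip]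

theorem fingerNext_symm_mid :
    (fingerNext τ hab).symm (Sum.inr true, false) = D.firstPiece b := by
  rw [Equiv.symm_apply_eq, fingerNext_first_under]

theorem fingerNext_symm_under_end :
    (fingerNext τ hab).symm (Sum.inr false, false) = (Sum.inr true, false) := by
  rw [Equiv.symm_apply_eq, fingerNext_mid]

/-- The old edge of which an edge is a piece. -/
def owner (a b : D.Edge) : (D.Crossing ⊕ Bool) × Bool → D.Edge
  | (.inl x, s) => (x, s)
  | (.inr _, true) => a
  | (.inr _, false) => b

@[simp] theorem owner_firstPiece (e : D.Edge) : owner a b (D.firstPiece e) = e := rfl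

@[simp] theorem owner_lastPiece (e : D.Edge) : owner a b (D.lastPiece a b τ e) = e := by
  unfold lastPiece
  split_ifs with h1 h2
  · exact h1.symm
  · exact h2.symm
  · rfl

theorem segment_firstPiece (e : D.Edge) :
    Segment D (finger τ hab) Sum.inl e (D.firstPiece e) := .start e

theorem segment_tip : Segment D (finger τ hab) Sum.inl a (Sum.inr τ, true) := by
  have h := Segment.cont (segment_firstPiece (τ := τ) hab a)
  rw [show (finger τ hab).next _ = _ from fingerNext_first_over hab] at h
  exact h (by simp)

theorem segment_over_end : Segment D (finger τ hab) Sum.inl a (Sum.inr (!τ), true) := by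
  have h := Segment.cont (segment_tip (τ := τ) hab)
  rw [show (finger τ hab).next _ = _ from fingerNext_tip hab] at h
  exact h (by simp)

theorem segment_mid : Segment D (finger τ hab) Sum.inl b (Sum.inr true, false) := by
  have h := Segment.cont (segment_firstPiece (τ := τ) hab b)
  rw [show (finger τ hab).next _ = _ from fingerNext_first_under hab] at h
  exact h (by simp)

theorem segment_under_end : Segment D (finger τ hab) Sum.inl b (Sum.inr false, false) := by
  have h := Segment.cont (segment_mid (τ := τ) hab)
  rw [show (finger τ hab).next _ = _ from fingerNext_mid hab] at h
  exact h (by simp)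

theorem segment_owner (e' : (finger τ hab).Edge) :
    Segment D (finger τ hab) Sum.inl (owner a b e') e' := by
  rcases e' with ⟨x | s, _ | _⟩
  · exact .start _
  · exact .start _
  · cases s
    · exact segment_under_end hab
    · exact segment_mid hab
  · rcases Bool.eq_or_eq_not s τ with h | h
    · subst h
      exact segment_tip hab
    · subst h
      exact segment_over_end hab

theorem owner_of_fingerNext {e' : (finger τ hab).Edge} {s t : Bool}
    (h : fingerNext τ hab e' = (Sum.inr s, t)) : owner a b e' = if t then a else b := by
  rw [← Equiv.eq_symm_apply] at h
  subst h
  cases t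
  · cases s
    · rw [fingerNext_symm_under_end]; rfl
    · rw [fingerNext_symm_mid]; rfl
  · rcases Bool.eq_or_eq_not s τ with h | h
    · subst h
      rw [fingerNext_symm_tip]; rfl
    · subst h
      rw [fingerNext_symm_over_end]; rfl

theorem owner_of_segment {e : D.Edge} {e' : (finger τ hab).Edge}
    (h : Segment D (finger τ hab) Sum.inl e e') : owner a b e' = e := by
  induction h with
  | start => rfl
  | @cont e' h hr ih =>
    rcases h' : (finger τ hab).next e' with ⟨x | s, t⟩
    · simp [h'] at hr
    · rw [← ih, owner_of_fingerNext hab h']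
      cases t <;> rfl

theorem erasure_finger : Erasure D (finger τ hab) Sum.inl where
  inj := Sum.inl_injective
  pos_eq _ := rfl
  next_eq e e' f h hf := by
    have h2 : e' = (fingerNext τ hab).symm (D.firstPiece f) := by
      rw [Equiv.eq_symm_apply]; exact hf
    rw [← owner_of_segment hab h, h2, fingerNext_symm_first, owner_lastPiece,
      Equiv.apply_symm_apply]
  covers e' := ⟨_, segment_owner hab e'⟩

/-- The over-edge of the bigon starts at the crossing of sign `τ` and its under-edge ends at the
negative one, so the face condition of `Move.R2` becomes exactly `hface`. -/
theorem move_finger (hface : D.SameFace (a, false) (b, τ)) :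
    Move D (finger τ hab) fun e e' => Segment D (finger τ hab) Sum.inl e e' ∧
      e' ≠ (Sum.inr τ, true) ∧ e' ≠ (Sum.inr true, false) := by
  refine Move.R2 (D' := finger τ hab) Sum.inl (Sum.inr τ) (Sum.inr (!τ)) (Sum.inr true)
    (Sum.inr false) a b (erasure_finger hab) (by simp) ?_ ?_ (by simp) (fingerNext_tip hab)
    (fingerNext_mid hab) (segment_tip hab) (segment_mid hab) hface
  · ext (x | s)
    · simp
    · cases s <;> cases τ <;> simp
  · cases τ <;> simp

section Coloring

variable {X : Type*} [Quandle X] {C : D.Edge → X}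

open Classical in
/-- The coloring of the diagram after the finger move. -/
noncomputable def fingerColor (C : D.Edge → X) (a b : D.Edge)
    (e' : (D.Crossing ⊕ Bool) × Bool) : X :=
  if e' = (Sum.inr true, false) then C a ◃ C b else C (owner a b e')

theorem fingerColor_mid : fingerColor C a b (Sum.inr true, false) = C a ◃ C b := if_pos rfl

theorem fingerColor_of_ne {e' : (D.Crossing ⊕ Bool) × Bool} (h : e' ≠ (Sum.inr true, false)) :
    fingerColor C a b e' = C (owner a b e') := if_neg h

@[simp] theorem fingerColor_firstPiece (e : D.Edge) :
    fingerColor C a b (D.firstPiece e) = C e :=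
  fingerColor_of_ne (by simp [firstPiece])

@[simp] theorem fingerColor_over (s : Bool) : fingerColor C a b (Sum.inr s, true) = C a :=
  fingerColor_of_ne (by simp)

@[simp] theorem fingerColor_under_end : fingerColor C a b (Sum.inr false, false) = C b :=
  fingerColor_of_ne (by simp)

@[simp] theorem fingerColor_lastPiece (e : D.Edge) :
    fingerColor C a b (D.lastPiece a b τ e) = C e := by
  rw [fingerColor_of_ne, owner_lastPiece]
  unfold lastPiece firstPiece
  split_ifs <;> simp

/-- Along `b` the positive crossing applies `C a ◃ ·` and the negative one undoes it, so only the
piece of `b` below the finger is recolored, independently of `τ`. -/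
theorem isColoring_finger (hC : D.IsColoring C) :
    (finger τ hab).IsColoring (fingerColor C a b) := by
  rintro (x | s)
  · have h1 : ∀ s, (fingerNext τ hab).symm (Sum.inl x, s) =
      D.lastPiece a b τ (D.next.symm (x, s)) := fun s => fingerNext_symm_first hab (x, s)
    have h2 : ∀ s, fingerColor C a b (Sum.inl x, s) = C (x, s) :=
      fun s => fingerColor_firstPiece (x, s)
    simpa [h1, h2] using hC x
  · refine ⟨?_, ?_, ?_⟩
    · change fingerColor C a b ((fingerNext τ hab).symm _) = _
      rcases Bool.eq_or_eq_not s τ with h | h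
      · subst h
        simp [fingerNext_symm_tip]
      · subst h
        simp [fingerNext_symm_over_end]
    · rintro (rfl : s = true)
      change _ = _ ◃ fingerColor C a b ((fingerNext τ hab).symm _)
      simp [fingerNext_symm_mid, fingerColor_mid]
    · rintro (rfl : s = false)
      change fingerColor C a b ((fingerNext τ hab).symm _) = _
      simp [fingerNext_symm_under_end, fingerColor_mid]

theorem coloredMove_finger (hC : D.IsColoring C) (hface : D.SameFace (a, false) (b, τ)) :
    ColoredMove ⟨D, C⟩ ⟨finger τ hab, fingerColor C a b⟩ := by
  refine ⟨hC, isColoring_finger hab hC, _, move_finger hab hface, ?_, ?_⟩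
  · rintro e e' ⟨h, -, h2⟩
    change C e = fingerColor C a b e'
    rw [fingerColor_of_ne h2, owner_of_segment hab h]
  · exact ⟨D.outer.1, D.firstPiece D.outer.1, D.outer.2,
      ⟨segment_firstPiece hab _, by simp [firstPiece], by simp [firstPiece]⟩,
      .refl _, .refl _⟩

/-- If the witness is `a`, its first piece now ends over a new crossing. Otherwise its last piece
still ends over the old one. -/
theorem HasOver.finger {c : X} (h : D.HasOver C c) :
    (finger τ hab).HasOver (fingerColor C a b) c := by
  obtain ⟨e, x, rfl, hx, hne⟩ := h
  by_cases ha : e = a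
  · subst ha
    exact ⟨D.firstPiece e, Sum.inr τ, fingerColor_firstPiece e, fingerNext_first_over hab,
      by simp [firstPiece]⟩
  · refine ⟨D.lastPiece a b τ e, Sum.inl x, fingerColor_lastPiece e,
      (fingerNext_last hab e).trans (by rw [hx]; rfl), ?_⟩
    simp only [lastPiece, firstPiece]
    split_ifs <;> simp [hne]

end Coloring

/-- A predicate that is constant along edges agrees on all pieces of an old edge, and hence descends
to the old diagram. -/
theorem Connected.finger (h : D.Connected) : (finger τ hab).Connected := by
  intro f hf
  have key (e' : (Diagram.finger τ hab).Edge) : f e'.1 ↔ f (Sum.inl (owner a b e').1) := by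
    have := segment_owner hab e'
    generalize owner a b e' = e at this
    induction this with
    | start => rfl
    | cont _ _ ih => exact (hf _).trans ih
  have h2 := h (fun x => f (Sum.inl x)) fun e => by
    have h3 := key (D.lastPiece a b τ e)
    rw [owner_lastPiece] at h3
    rw [← h3, ← hf]
    exact iff_of_eq (congrArg (fun z => f z.1) (fingerNext_last hab e).symm)
  intro x y
  exact (key (x, true)).trans ((h2 _ _).trans (key (y, true)).symm)

end FingerLemmas

/-! ### Faces, and how a finger changes them. -/

section Faces

variable {D : Diagram}

theorem faceNext_left {e : D.Edge} {y : D.Crossing} {s : Bool} (h : D.next e = (y, s)) :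
    D.faceNext (e, true) =
      if s = D.pos y then ((y, !s), true) else (D.next.symm (y, !s), false) := by
  simp [faceNext, h]

theorem faceNext_right (x : D.Crossing) (s : Bool) :
    D.faceNext ((x, s), false) =
      if s = D.pos x then (D.next.symm (x, !s), false) else ((x, !s), true) := rfl

theorem faceNext_left_of_eq {e : D.Edge} {y : D.Crossing} {s : Bool} (h : D.next e = (y, s))
    (hs : s = D.pos y) : D.faceNext (e, true) = ((y, !s), true) :=
  (faceNext_left h).trans (if_pos hs)

theorem faceNext_left_of_ne {e f : D.Edge} {y : D.Crossing} {s : Bool} (h : D.next e = (y, s))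
    (hs : s ≠ D.pos y) (hf : D.next.symm (y, !s) = f) : D.faceNext (e, true) = (f, false) :=
  ((faceNext_left h).trans (if_neg hs)).trans (by rw [hf])

theorem faceNext_right_of_eq {f : D.Edge} {x : D.Crossing} {s : Bool}
    (hs : s = D.pos x) (hf : D.next.symm (x, !s) = f) :
    D.faceNext ((x, s), false) = (f, false) :=
  (if_pos hs).trans (by rw [hf])

theorem faceNext_right_of_ne {x : D.Crossing} {s : Bool} (hs : s ≠ D.pos x) :
    D.faceNext ((x, s), false) = ((x, !s), true) := if_neg hs

theorem SameFace.step (s : D.Side) : D.SameFace s (D.faceNext s) := .rel _ _ rfl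

theorem SameFace.of_eq {s t : D.Side} (h : D.faceNext s = t) : D.SameFace s t := .rel _ _ h

theorem SameFace.symm {s t : D.Side} (h : D.SameFace s t) : D.SameFace t s :=
  Relation.EqvGen.symm _ _ h

theorem SameFace.trans {s t r : D.Side} (h : D.SameFace s t) (h' : D.SameFace t r) :
    D.SameFace s r := Relation.EqvGen.trans _ _ _ h h'

/-- The edges around a crossing are related by face steps, and hence all sides of a connected
diagram are related by face steps and by passing to the other side of an edge. -/
theorem Connected.side_iff (h : D.Connected) (P : D.Side → Prop)
    (hface : ∀ s, P s ↔ P (D.faceNext s)) (hflip : ∀ e, P (e, true) ↔ P (e, false))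
    (s t : D.Side) : P s ↔ P t := by
  have hP (e : D.Edge) (i j : Bool) : P (e, i) ↔ P (e, j) := by
    cases i <;> cases j <;> simp [hflip]
  have around (x : D.Crossing) : (P ((x, true), true) ↔ P ((x, false), true)) ∧
      (P (D.next.symm (x, true), true) ↔ P ((x, true), true)) ∧
      (P (D.next.symm (x, false), true) ↔ P ((x, true), true)) := by
    have h1 := hface (D.next.symm (x, true), true)
    have h2 := hface (D.next.symm (x, false), true)
    have h3 := hface ((x, true), false)
    rw [faceNext_left (D.next.apply_symm_apply _)] at h1 h2
    rw [faceNext_right] at h3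
    cases hx : D.pos x <;> simp [hx, ← hflip] at h1 h2 h3 <;> tauto
  have all (x : D.Crossing) (i j k : Bool) :
      (P ((x, i), j) ↔ P ((x, true), true)) ∧
      (P (D.next.symm (x, i), k) ↔ P ((x, true), true)) := by
    obtain ⟨h1, h2, h3⟩ := around x
    rw [hP _ j true, hP _ k true]
    cases i
    · exact ⟨h1.symm, h3⟩
    · exact ⟨Iff.rfl, h2⟩
  have key := h (fun x => P ((x, true), true)) fun e => by
    have h1 := (all (D.next e).1 (D.next e).2 true true).2
    rw [Prod.mk.eta, Equiv.symm_apply_apply] at h1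
    exact h1.symm.trans (all e.1 e.2 true true).1
  obtain ⟨⟨x, i⟩, j⟩ := s
  obtain ⟨⟨y, i'⟩, j'⟩ := t
  rw [(all x i j true).1, (all y i' j' true).1]
  exact key x y

end Faces

section FingerFaces

variable {D : Diagram} {a b : D.Edge} {τ : Bool} (hab : a ≠ b)

/-- The tip of the finger looks into the face beyond `b`. This allows the finger to be pushed on
from its tip. -/
theorem sameFace_tip : (finger τ hab).SameFace ((Sum.inr τ, true), false)
    (D.firstPiece b, !τ) := by
  cases τ
  · exact (SameFace.of_eq (faceNext_left_of_ne (fingerNext_first_under hab) Bool.false_ne_true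
      (fingerNext_symm_over_end hab))).symm
  · exact SameFace.of_eq (faceNext_right_of_eq rfl (fingerNext_symm_mid hab))

theorem sameFace_under_end : (finger τ hab).SameFace ((Sum.inr τ, true), false)
    ((Sum.inr false, false), !τ) := by
  cases τ
  · exact SameFace.of_eq (faceNext_right_of_ne Bool.false_ne_true.symm)
  · exact (SameFace.of_eq (faceNext_right_of_eq rfl (fingerNext_symm_over_end hab))).symm

theorem sameFace_over : (finger τ hab).SameFace (D.firstPiece a, true)
    ((Sum.inr (!τ), true), true) := by
  have h1 : (finger τ hab).faceNext (D.firstPiece a, true) = ((Sum.inr true, false), τ) := by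
    cases τ
    · exact faceNext_left_of_ne (fingerNext_first_over hab) Bool.false_ne_true.symm
        (fingerNext_symm_under_end hab)
    · exact faceNext_left_of_eq (fingerNext_first_over hab) rfl
  have h2 : (finger τ hab).faceNext ((Sum.inr true, false), τ) =
      ((Sum.inr (!τ), true), true) := by
    cases τ
    · exact faceNext_right_of_ne Bool.false_ne_true
    · exact faceNext_left_of_eq (fingerNext_mid hab) rfl
  exact (SameFace.of_eq h1).trans (SameFace.of_eq h2)

/-- The finger cuts only the two sides that faced each other. The left of `a` stays connected
through the inside of the finger, and the far side of `b` around the tip. -/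
theorem sameFace_pieces {e : D.Edge} {i : Bool} (ha : ¬(e = a ∧ i = false))
    (hb : ¬(e = b ∧ i = τ)) :
    (finger τ hab).SameFace (D.firstPiece e, i) (D.lastPiece a b τ e, i) := by
  by_cases h1 : e = a
  · subst h1
    obtain rfl : i = true := by simpa using ha
    rw [lastPiece_over]
    exact sameFace_over hab
  · by_cases h2 : e = b
    · subst h2
      obtain rfl : i = !τ := by simpa [Bool.eq_not] using hb
      rw [lastPiece_under hab]
      exact (sameFace_tip hab).symm.trans (sameFace_under_end hab)
    · rw [lastPiece_of_ne h1 h2]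
      exact .refl _

/-- The piece of a side at which a walk with the side on the left hand begins. -/
noncomputable def sideStart (D : Diagram) (a b : D.Edge) (τ : Bool) :
    D.Side → ((D.Crossing ⊕ Bool) × Bool) × Bool
  | (e, true) => (D.firstPiece e, true)
  | (e, false) => (D.lastPiece a b τ e, false)

/-- The piece of a side at which a walk with the side on the left hand ends. -/
noncomputable def sideEnd (D : Diagram) (a b : D.Edge) (τ : Bool) :
    D.Side → ((D.Crossing ⊕ Bool) × Bool) × Bool
  | (e, true) => (D.lastPiece a b τ e, true)
  | (e, false) => (D.firstPiece e, false)

/-- The corners at old crossings are untouched by the finger. -/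
theorem faceNext_sideEnd (s : D.Side) :
    (finger τ hab).faceNext (D.sideEnd a b τ s) = D.sideStart a b τ (D.faceNext s) := by
  obtain ⟨⟨x, i⟩, _ | _⟩ := s
  · by_cases h : i = D.pos x
    · rw [faceNext_right_of_eq h rfl]
      exact faceNext_right_of_eq (D := finger τ hab) h (fingerNext_symm_first hab (x, !i))
    · rw [faceNext_right_of_ne h]
      exact faceNext_right_of_ne (D := finger τ hab) h
  · rcases hn : D.next (x, i) with ⟨y, j⟩
    have hn' := (fingerNext_last (τ := τ) hab (x, i)).trans (congrArg D.firstPiece hn)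
    by_cases h : j = D.pos y
    · rw [faceNext_left_of_eq hn h]
      exact faceNext_left_of_eq (D := finger τ hab) hn' h
    · rw [faceNext_left_of_ne hn h rfl]
      exact faceNext_left_of_ne (D := finger τ hab) hn' h (fingerNext_symm_first hab (y, !j))

theorem SameFace.finger_step (hface : D.SameFace (a, false) (b, τ)) {s : D.Side}
    (hs : ¬ D.SameFace (a, false) s) :
    (finger τ hab).SameFace (D.firstPiece s.1, s.2)
      (D.firstPiece (D.faceNext s).1, (D.faceNext s).2) := by
  have pieces {s : D.Side} (hs : ¬ D.SameFace (a, false) s) :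
      (finger τ hab).SameFace (D.firstPiece s.1, s.2) (D.lastPiece a b τ s.1, s.2) := by
    refine sameFace_pieces hab ?_ ?_
    · rintro ⟨h1, h2⟩
      exact hs (by rw [← h1, ← h2]; exact .refl _)
    · rintro ⟨h1, h2⟩
      exact hs (by rw [← h1, ← h2] at hface; exact hface)
  have h1 : (finger τ hab).SameFace (D.firstPiece s.1, s.2) (D.sideEnd a b τ s) := by
    obtain ⟨e, _ | _⟩ := s
    · exact .refl _
    · exact pieces hs
  have h2 {s : D.Side} (hs : ¬ D.SameFace (a, false) s) :
      (finger τ hab).SameFace (D.sideStart a b τ s) (D.firstPiece s.1, s.2) := by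
    obtain ⟨e, _ | _⟩ := s
    · exact (pieces hs).symm
    · exact .refl _
  exact (h1.trans (SameFace.of_eq (faceNext_sideEnd hab s))).trans
    (h2 fun h => hs (h.trans (SameFace.step s).symm))

/-- A finger move splits one face and preserves all the others. -/
theorem SameFace.finger (hface : D.SameFace (a, false) (b, τ)) {s t : D.Side}
    (h : D.SameFace s t) (hs : ¬ D.SameFace (a, false) s) :
    (finger τ hab).SameFace (D.firstPiece s.1, s.2) (D.firstPiece t.1, t.2) := by
  induction h with
  | rel s t h =>
    subst h
    exact SameFace.finger_step hab hface hs
  | refl => exact .refl _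
  | symm s t h ih => exact (ih fun h' => hs (SameFace.trans h' h)).symm
  | trans s t r h _ ih1 ih2 =>
    exact (ih1 hs).trans (ih2 fun h' => hs (SameFace.trans h' (SameFace.symm h)))

end FingerFaces

/-! ### Walks through faces, and the colors that fingers produce. -/

section Reach

variable {D : Diagram}

/-- The face of `t` can be reached from that of `s` by crossing `n` edges different from `a`. -/
def Reach (D : Diagram) (a : D.Edge) : ℕ → D.Side → D.Side → Prop
  | 0, s, t => D.SameFace s t
  | n + 1, s, t => ∃ e i, e ≠ a ∧ D.SameFace s (e, i) ∧ D.Reach a n (e, !i) t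

/-- As `Reach`, but without visiting the face of `s₀`. -/
def ReachOff (D : Diagram) (a : D.Edge) (s₀ : D.Side) : ℕ → D.Side → D.Side → Prop
  | 0, s, t => ¬ D.SameFace s₀ s ∧ D.SameFace s t
  | n + 1, s, t => ¬ D.SameFace s₀ s ∧
      ∃ e i, e ≠ a ∧ D.SameFace s (e, i) ∧ D.ReachOff a s₀ n (e, !i) t

theorem Reach.of_sameFace {a : D.Edge} {n : ℕ} {s s' t : D.Side} (h : D.SameFace s' s)
    (hr : D.Reach a n s t) : D.Reach a n s' t := by
  cases n with
  | zero => exact SameFace.trans h hr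
  | succ n =>
    obtain ⟨e, i, he, hs, hr⟩ := hr
    exact ⟨e, i, he, h.trans hs, hr⟩

theorem Reach.trans {a : D.Edge} {n m : ℕ} {s t r : D.Side} (h : D.Reach a n s t)
    (h' : D.Reach a m t r) : D.Reach a (n + m) s r := by
  induction n generalizing s with
  | zero =>
    rw [Nat.zero_add]
    exact h'.of_sameFace h
  | succ n ih =>
    obtain ⟨e, i, he, hs, hr⟩ := h
    rw [Nat.succ_add]
    exact ⟨e, i, he, hs, ih hr⟩

/-- A walk that visits the face of `s₀` can be started there instead, without becoming longer. -/
theorem Reach.off_or {a : D.Edge} {n : ℕ} {s t : D.Side} (h : D.Reach a n s t) (s₀ : D.Side) :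
    D.ReachOff a s₀ n s t ∨ ∃ m ≤ n, D.Reach a m s₀ t := by
  induction n generalizing s with
  | zero =>
    by_cases hs : D.SameFace s₀ s
    · exact .inr ⟨0, le_rfl, h.of_sameFace hs⟩
    · exact .inl ⟨hs, h⟩
  | succ n ih =>
    by_cases hs : D.SameFace s₀ s
    · exact .inr ⟨n + 1, le_rfl, h.of_sameFace hs⟩
    · obtain ⟨e, i, he, hs', hr⟩ := h
      rcases ih hr with h1 | ⟨m, hm, h1⟩
      · exact .inl ⟨hs, e, i, he, hs', h1⟩
      · exact .inr ⟨m, hm.trans n.le_succ, h1⟩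

/-- The finger splits only the face of `(a, false)`, so a walk avoiding that face survives. It now
crosses first pieces, none of which is the tip. -/
theorem ReachOff.finger {a b : D.Edge} {τ : Bool} (hab : a ≠ b)
    (hface : D.SameFace (a, false) (b, τ)) {n : ℕ} {s t : D.Side}
    (h : D.ReachOff a (a, false) n s t) :
    (finger τ hab).Reach (Sum.inr τ, true) n (D.firstPiece s.1, s.2) (D.firstPiece t.1, t.2) := by
  induction n generalizing s with
  | zero => exact SameFace.finger hab hface h.2 h.1
  | succ n ih =>
    obtain ⟨hs, e, i, -, hs', hr⟩ := h
    exact ⟨D.firstPiece e, i, by simp [firstPiece], SameFace.finger hab hface hs' hs, ih hr⟩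

/-- If `a` ends over a crossing which is not the one at its tail, then one can walk around the
head of `a` from its left to its right. -/
theorem exists_reach_flip {a : D.Edge} {x : D.Crossing} (hx : D.next a = (x, true))
    (hne : a.1 ≠ x) (i : Bool) : ∃ n, D.Reach a n (a, i) (a, !i) := by
  have hs : D.next.symm (x, true) = a := by rw [Equiv.symm_apply_eq, hx]
  have h1 : (x, true) ≠ a := fun h => hne (by rw [← h])
  have h2 : (x, false) ≠ a := fun h => hne (by rw [← h])
  have h3 : D.next.symm (x, false) ≠ a := fun h => by
    rw [Equiv.symm_apply_eq, hx] at h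
    simp at h
  -- These are the four corners at `x`. Crossing the three other edges at `x` one after another
  -- leads around the head of `a`.
  have f1 := faceNext_left hx
  have f2 := faceNext_right x false
  have f3 := faceNext_right x true
  have f4 := faceNext_left (D.next.apply_symm_apply (x, false))
  cases hp : D.pos x <;> simp [hp, hs] at f1 f2 f3 f4
  · have g1 := SameFace.of_eq f1
    have g2 := SameFace.of_eq f2
    have g3 := SameFace.of_eq f3
    have g4 := SameFace.of_eq f4
    cases i
    · exact ⟨3, _, _, h2, g2.symm, _, _, h1, g3.symm, _, _, h3, g4.symm, g1.symm⟩
    · exact ⟨3, _, _, h3, g1, _, _, h1, g4, _, _, h2, g3, g2⟩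
  · have g1 := SameFace.of_eq f1
    have g2 := SameFace.of_eq f2
    have g3 := SameFace.of_eq f3
    have g4 := SameFace.of_eq f4
    cases i
    · exact ⟨3, _, _, h3, g4.symm, _, _, h1, g3.symm, _, _, h2, g2.symm, g1.symm⟩
    · exact ⟨3, _, _, h2, g1, _, _, h1, g2, _, _, h3, g3, g4⟩

theorem Connected.exists_reach (h : D.Connected) {a : D.Edge} {x : D.Crossing}
    (hx : D.next a = (x, true)) (hne : a.1 ≠ x) (s t : D.Side) : ∃ n, D.Reach a n s t := by
  have flip (e : D.Edge) (i : Bool) : ∃ n, D.Reach a n (e, i) (e, !i) := by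
    by_cases he : e = a
    · subst he
      exact exists_reach_flip hx hne i
    · exact ⟨1, e, i, he, .refl _, .refl _⟩
  refine (h.side_iff (fun t => ∃ n, D.Reach a n s t) ?_ ?_ s t).1 ⟨0, .refl _⟩
  · intro t
    have h1 : D.Reach a 0 t (D.faceNext t) := SameFace.step t
    have h2 : D.Reach a 0 (D.faceNext t) t := (SameFace.step t).symm
    exact ⟨fun ⟨n, hn⟩ => ⟨n, hn.trans h1⟩, fun ⟨n, hn⟩ => ⟨n, hn.trans h2⟩⟩
  · intro e
    obtain ⟨m, hm⟩ := flip e true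
    obtain ⟨m', hm'⟩ := flip e false
    exact ⟨fun ⟨n, hn⟩ => ⟨_, hn.trans hm⟩, fun ⟨n, hn⟩ => ⟨_, hn.trans hm'⟩⟩

end Reach

section Colors

variable {X : Type*} [Quandle X]

/-- Properties of colored diagrams that are preserved by pushing fingers. -/
structure Enlarges (A B : ColoredDiagram X) : Prop where
  requiv : REquiv A B
  isColoring : B.1.IsColoring B.2
  connected : A.1.Connected → B.1.Connected
  hasOver : ∀ c, A.1.HasOver A.2 c → B.1.HasOver B.2 c

/-- Induction on the number of edges to be crossed: push the finger over the first edge `e` and go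
on from the tip, which still has color `C a`. If the rest of the walk returns to the face of `(a,
false)`, which the push would split, use the shorter walk from there and do not push. Crossing `a`
is excluded since a finger is pushed over a different edge. -/
theorem exists_act_color_of_reach (n : ℕ) (D : Diagram) (C : D.Edge → X) (hC : D.IsColoring C)
    (a b : D.Edge) (τ : Bool) (h : D.Reach a n (a, false) (b, τ)) :
    ∃ B : ColoredDiagram X, Enlarges ⟨D, C⟩ B ∧ ∃ e, B.2 e = C a ◃ C b := by
  induction n using Nat.strong_induction_on generalizing D with
  | _ n ih =>
  have move {e : D.Edge} {i : Bool} (hae : a ≠ e) (hf : D.SameFace (a, false) (e, i)) :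
      Enlarges ⟨D, C⟩ ⟨finger i hae, fingerColor C a e⟩ :=
    ⟨.rel _ _ (coloredMove_finger hae hC hf), isColoring_finger hae hC, Connected.finger hae,
      fun _ => HasOver.finger hae⟩
  cases n with
  | zero =>
    by_cases hab : a = b
    · exact ⟨⟨D, C⟩, ⟨.refl _, hC, id, fun _ => id⟩, a, by rw [← hab, Quandle.fix]⟩
    · exact ⟨_, move hab h, (Sum.inr true, false), fingerColor_mid⟩
  | succ n =>
    obtain ⟨e, i, he, hs, hr⟩ := h
    rcases hr.off_or (a, false) with hr | ⟨m, hm, hr⟩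
    · have h1 := (hr.finger he.symm hs).of_sameFace (sameFace_tip he.symm)
      obtain ⟨B, hB, e', he'⟩ := ih n n.lt_succ_self (finger i he.symm) (fingerColor C a e)
        (isColoring_finger _ hC) (Sum.inr i, true) (D.firstPiece b) h1
      have h2 := move he.symm hs
      refine ⟨B, ⟨.trans _ _ _ h2.requiv hB.requiv, hB.isColoring, hB.connected ∘ h2.connected,
        fun c hc => hB.hasOver c (h2.hasOver c hc)⟩, e', ?_⟩
      rw [he', fingerColor_firstPiece, fingerColor_over]
    · exact ih m (Nat.lt_succ_of_le hm) D C hC a b hr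

theorem exists_act_color {D : Diagram} {C : D.Edge → X} (hC : D.IsColoring C)
    (hD : D.Connected) {c : X} (hc : D.HasOver C c) (b : D.Edge) :
    ∃ B : ColoredDiagram X, Enlarges ⟨D, C⟩ B ∧ ∃ e, B.2 e = c ◃ C b := by
  obtain ⟨a, x, rfl, hx, hne⟩ := hc
  obtain ⟨n, hn⟩ := hD.exists_reach hx hne (a, false) (b, true)
  exact exists_act_color_of_reach n D C hC a b true hn

end Colors

/-! ### Subquandles containing all colors are invariant under moves. -/

section Invariance

variable {X : Type*} [Quandle X]

/-- A set closed under both operations of the quandle. -/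
structure QuandleClosed (S : Set X) : Prop where
  act {x y : X} : x ∈ S → y ∈ S → x ◃ y ∈ S
  invAct {x y : X} : x ∈ S → y ∈ S → x ◃⁻¹ y ∈ S

variable {D : Diagram} {C : D.Edge → X} {S : Set X}

theorem IsColoring.color_over (hC : D.IsColoring C) {e : D.Edge} {x : D.Crossing}
    (h : D.next e = (x, true)) : C e = C (x, true) := by
  rw [← (hC x).1, ← h, Equiv.symm_apply_apply]

theorem IsColoring.under_mem_iff (hC : D.IsColoring C) (hS : QuandleClosed S) {e : D.Edge}
    {x : D.Crossing} (h : D.next e = (x, false)) (hx : C (x, true) ∈ S) :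
    C e ∈ S ↔ C (x, false) ∈ S := by
  have hmem (z : X) : C (x, true) ◃ z ∈ S ↔ z ∈ S := by
    refine ⟨fun h => ?_, hS.act hx⟩
    have := hS.invAct hx h
    rwa [Rack.left_inv] at this
  obtain ⟨-, h1, h2⟩ := hC x
  rw [← h, Equiv.symm_apply_apply] at h1 h2
  rw [h] at h1 h2
  cases hp : D.pos x
  · rw [h2 hp, hmem]
  · rw [h1 hp, hmem]

/-- At one of its ends the loop is part of the over-strand, so it shares its color with the edge
before or after it. -/
theorem IsColoring.mem_of_kink (hC : D.IsColoring C) {c : D.Crossing} {s : Bool}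
    (hloop : D.next (c, s) = (c, !s)) (h : ∀ e, e ≠ (c, s) → C e ∈ S) (e : D.Edge) : C e ∈ S := by
  by_cases he : e = (c, s)
  · subst he
    cases s
    · rw [hC.color_over hloop]
      exact h _ (by simp)
    · rw [← hC.color_over (D.next.apply_symm_apply _)]
      refine h _ fun h' => ?_
      rw [Equiv.symm_apply_eq, hloop] at h'
      simp at h'
  · exact h e he

theorem IsColoring.mem_of_bigon (hC : D.IsColoring C) (hS : QuandleClosed S)
    {c d x y : D.Crossing} (hcd : c ≠ d) (hxy : (x = c ∧ y = d) ∨ (x = d ∧ y = c))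
    (hover : D.next (c, true) = (d, true)) (hunder : D.next (x, false) = (y, false))
    (h : ∀ e, e ≠ (c, true) → e ≠ (x, false) → C e ∈ S) (e : D.Edge) : C e ∈ S := by
  have hne : x ≠ y := by
    rcases hxy with ⟨rfl, rfl⟩ | ⟨rfl, rfl⟩
    · exact hcd
    · exact hcd.symm
  have hd : C (d, true) ∈ S := h _ (by simp [hcd.symm]) (by simp)
  have hc : C (c, true) ∈ S := by rwa [hC.color_over hover]
  by_cases h1 : e = (c, true)
  · rwa [h1]
  by_cases h2 : e = (x, false)
  · subst h2
    refine (hC.under_mem_iff hS hunder ?_).2 (h _ (by simp) (by simp [hne.symm]))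
    rcases hxy with ⟨-, rfl⟩ | ⟨-, rfl⟩
    · exact hd
    · exact hc
  exact h e h1 h2

/-- Work from top to bottom: `t` continues an over-strand, `m` does so at `z`, and `b` differs from
its successor by the action of an over-color already known to lie in `S`. -/
theorem IsColoring.mem_of_triangle (hC : D.IsColoring C) (hS : QuandleClosed S)
    {x y z : D.Crossing} {t m b : D.Edge} (hxy : x ≠ y) (hyz : y ≠ z) (hxz : x ≠ z)
    (ht : ({t, D.next t} : Set D.Edge) = {(x, true), (y, true)})
    (hm : ({m, D.next m} : Set D.Edge) = {(x, false), (z, true)})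
    (hb : ({b, D.next b} : Set D.Edge) = {(y, false), (z, false)})
    (h : ∀ e, e ≠ t → e ≠ m → e ≠ b → C e ∈ S) (e : D.Edge) : C e ∈ S := by
  rw [Set.pair_eq_pair_iff] at ht hm hb
  have tS : C t ∈ S := by
    have : C (D.next t) ∈ S := by apply h <;> grind
    rcases ht with ⟨h1, h2⟩ | ⟨h1, h2⟩ <;> rwa [hC.color_over h2, ← h2]
  have mS : C m ∈ S := by
    rcases hm with ⟨h3, h4⟩ | ⟨h3, h4⟩
    · rw [hC.color_over h4]
      apply h <;> grind
    · have h7 : D.next (D.next.symm m) = (z, true) := by rw [Equiv.apply_symm_apply, h3]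
      rw [h3, ← hC.color_over h7]
      apply h <;> rw [Ne, Equiv.symm_apply_eq] <;> grind
  have overS (v : D.Crossing) : C (v, true) ∈ S := by
    by_cases h1 : (v, true) = t
    · rwa [h1]
    by_cases h2 : (v, true) = m
    · rwa [h2]
    exact h _ h1 h2 (by grind)
  have bS : C b ∈ S := by
    have : C (D.next b) ∈ S := by apply h <;> grind
    rcases hb with ⟨h1, h2⟩ | ⟨h1, h2⟩ <;> rwa [hC.under_mem_iff hS h2 (overS _), ← h2]
  by_cases h1 : e = t
  · rwa [h1]
  by_cases h2 : e = m
  · rwa [h2]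
  by_cases h3 : e = b
  · rwa [h3]
  exact h e h1 h2 h3

theorem triangleSwap_over {K : Type} {x y z : K} (hxz : x ≠ z) (hyz : y ≠ z) :
    triangleSwap x y z (x, true) = (y, true) ∧ triangleSwap x y z (y, true) = (x, true) := by
  simp [triangleSwap, Equiv.swap_apply_def, hxz, hyz]

theorem triangleSwap_middle {K : Type} {x y z : K} (hxy : x ≠ y) (hxz : x ≠ z) (hyz : y ≠ z) :
    triangleSwap x y z (x, false) = (z, true) ∧ triangleSwap x y z (z, true) = (x, false) := by
  simp [triangleSwap, Equiv.swap_apply_def, hxy, hxz, hxz.symm, hyz.symm]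

theorem triangleSwap_under {K : Type} {x y z : K} (hxy : x ≠ y) (hxz : x ≠ z) :
    triangleSwap x y z (y, false) = (z, false) ∧ triangleSwap x y z (z, false) = (y, false) := by
  simp [triangleSwap, Equiv.swap_apply_def, hxy.symm, hxz.symm]

theorem _root_.ColoredMove.mem_iff (hS : QuandleClosed S) {A B : ColoredDiagram X}
    (h : ColoredMove A B) : (∀ e, A.2 e ∈ S) ↔ ∀ e, B.2 e ∈ S := by
  obtain ⟨D, C⟩ := A
  obtain ⟨D', C'⟩ := B
  obtain ⟨hC, hC', ρ, hρ, hcol, -⟩ := h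
  dsimp only at *
  cases hρ with
  | isotopy φ hpos hnext =>
    have hc (e : D.Edge) : C e = C' (φ e.1, e.2) := hcol e _ rfl
    constructor
    · intro h e
      have := hc (φ.symm e.1, e.2)
      rw [Equiv.apply_symm_apply] at this
      exact this ▸ h _
    · intro h e
      rw [hc]
      exact h _
  | R1 ι c s herase hrange hloop =>
    constructor
    · intro h
      refine hC'.mem_of_kink hloop fun e' he' => ?_
      obtain ⟨e, he⟩ := herase.covers e'
      exact hcol e e' ⟨he, he'⟩ ▸ h e
    · intro h e
      have h1 : ι e.1 ∈ ({c}ᶜ : Set _) := hrange ▸ Set.mem_range_self _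
      rw [hcol e _ ⟨.start e, fun h' => h1 (congrArg Prod.fst h')⟩]
      exact h _
  | R2 ι c d x y a b herase hcd hrange hxy hsign hover hunder ha hb hface =>
    constructor
    · intro h
      refine hC'.mem_of_bigon hS hcd hxy hover hunder fun e' h1 h2 => ?_
      obtain ⟨e, he⟩ := herase.covers e'
      exact hcol e e' ⟨he, h1, h2⟩ ▸ h e
    · intro h e
      have h1 : ι e.1 ∈ ({c, d}ᶜ : Set _) := hrange ▸ Set.mem_range_self _
      have h2 : x ∈ ({c, d} : Set _) := by
        rcases hxy with ⟨rfl, -⟩ | ⟨rfl, -⟩ <;> simp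
      rw [hcol e _ ⟨.start e, fun h' => h1 (.inl (congrArg Prod.fst h')),
        fun h' => h1 (by rwa [show ι e.1 = x from congrArg Prod.fst h'])⟩]
      exact h _
  | R3 φ x y z t m b hxy hyz hxz ht hm hb hface hpos hnext =>
    let ψ : D.Edge ≃ D'.Edge := (triangleSwap x y z).trans (φ.prodCongr (Equiv.refl Bool))
    have hψ (e : D.Edge) : D'.next (ψ e) = ψ (D.next e) := hnext e _ rfl
    have hc (e : D.Edge) (h1 : e ≠ t) (h2 : e ≠ m) (h3 : e ≠ b) : C e = C' (ψ e) :=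
      hcol e _ ⟨rfl, h1, h2, h3⟩
    have hpair {t p q : D.Edge} (ht : ({t, D.next t} : Set D.Edge) = {p, q}) :
        ({ψ t, D'.next (ψ t)} : Set D'.Edge) = {ψ p, ψ q} := by
      rw [hψ, ← Set.image_pair, ht, Set.image_pair]
    have hval (e : D.Edge) : ψ e = (φ (triangleSwap x y z e).1, (triangleSwap x y z e).2) := rfl
    constructor
    · intro h
      have ht' := hpair ht
      have hm' := hpair hm
      have hb' := hpair hb
      simp only [hval, triangleSwap_over hxz hyz, triangleSwap_middle hxy hxz hyz,
        triangleSwap_under hxy hxz] at ht' hm' hb'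
      -- `triangleSwap` exchanges the two entries of each pair, so `φ x`, `φ y`, `φ z` play the same
      -- roles in the triangle of `D'`.
      rw [Set.pair_comm (_, true)] at ht'
      rw [Set.pair_comm (_, true)] at hm'
      rw [Set.pair_comm (φ z, false)] at hb'
      refine hC'.mem_of_triangle hS (φ.injective.ne hxy) (φ.injective.ne hyz)
        (φ.injective.ne hxz) ht' hm' hb' fun e h1 h2 h3 => ?_
      obtain ⟨e, rfl⟩ := ψ.surjective e
      rw [← hc e (fun h => h1 (h ▸ rfl)) (fun h => h2 (h ▸ rfl)) (fun h => h3 (h ▸ rfl))]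
      exact h e
    · intro h
      refine hC.mem_of_triangle hS hxy hyz hxz ht hm hb fun e h1 h2 h3 => ?_
      rw [hc e h1 h2 h3]
      exact h _

theorem _root_.REquiv.mem_iff (hS : QuandleClosed S) {A B : ColoredDiagram X}
    (h : REquiv A B) : (∀ e, A.2 e ∈ S) ↔ ∀ e, B.2 e ∈ S := by
  induction h with
  | rel _ _ h => exact h.mem_iff hS
  | refl => rfl
  | symm _ _ _ ih => exact ih.symm
  | trans _ _ _ _ _ ih1 ih2 => exact ih1.trans ih2

end Invariance

end Diagram

/-! ### The torus diagram: connectedness and colorings. -/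

section Torus

theorem torusNext_over_of_lt {m n : ℕ} {i : Fin n} {j : Fin (m - 1)} (h : j.val + 1 < m - 1) :
    torusNext m n ((i, j), true) = ((i, ⟨j.val + 1, h⟩), true) := dif_pos h

theorem torusNext_over_of_not_lt {m n : ℕ} {i : Fin n} {j : Fin (m - 1)}
    (h : ¬ j.val + 1 < m - 1) :
    torusNext m n ((i, j), true) = ((finRotate n i, j), false) := dif_neg h

theorem torusNext_under_of_pos {m n : ℕ} {i : Fin n} {j : Fin (m - 1)} (h : 0 < j.val) :
    torusNext m n ((i, j), false) = ((finRotate n i, ⟨j.val - 1, by omega⟩), false) := dif_pos h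

theorem torusNext_under_of_not_pos {m n : ℕ} {i : Fin n} {j : Fin (m - 1)} (h : ¬ 0 < j.val) :
    torusNext m n ((i, j), false) = ((finRotate n i, j), true) := dif_neg h

theorem torusNext_symm_over_of_pos {m n : ℕ} {i : Fin n} {j : Fin (m - 1)} (h : 0 < j.val) :
    (torusNext m n).symm ((i, j), true) = ((i, ⟨j.val - 1, by omega⟩), true) := dif_pos h

theorem torusNext_symm_over_of_not_pos {m n : ℕ} {i : Fin n} {j : Fin (m - 1)}
    (h : ¬ 0 < j.val) :
    (torusNext m n).symm ((i, j), true) = (((finRotate n).symm i, j), false) := dif_neg h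

theorem torusNext_symm_under_of_lt {m n : ℕ} {i : Fin n} {j : Fin (m - 1)}
    (h : j.val + 1 < m - 1) :
    (torusNext m n).symm ((i, j), false) = (((finRotate n).symm i, ⟨j.val + 1, h⟩), false) :=
  dif_pos h

theorem torusNext_symm_under_of_not_lt {m n : ℕ} {i : Fin n} {j : Fin (m - 1)}
    (h : ¬ j.val + 1 < m - 1) :
    (torusNext m n).symm ((i, j), false) = (((finRotate n).symm i, j), true) := dif_neg h

theorem finRotate_iterate_eq {n : ℕ} (f : Fin n → Prop)
    (h : ∀ i, f (finRotate n i) ↔ f i) (i j : Fin n) : f i ↔ f j := by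
  have key (k : ℕ) (hk : k < n) : f ⟨k, hk⟩ ↔ f ⟨0, by omega⟩ := by
    induction k with
    | zero => rfl
    | succ k ih =>
      obtain ⟨n, rfl⟩ : ∃ n', n = n' + 1 := ⟨n - 1, by omega⟩
      rw [← ih (by omega), ← h ⟨k, by omega⟩, finRotate_of_lt (by omega)]
  exact (key i i.2).trans (key j j.2).symm

theorem torusNext_connected {m n : ℕ} (hm : 2 ≤ m) (f : Fin n × Fin (m - 1) → Prop)
    (h : ∀ e, f (torusNext m n e).1 ↔ f e.1) (x y : Fin n × Fin (m - 1)) : f x ↔ f y := by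
  have col (i : Fin n) (j : ℕ) (hj : j < m - 1) : f (i, ⟨j, hj⟩) ↔ f (i, ⟨0, by omega⟩) := by
    induction j with
    | zero => rfl
    | succ j ih =>
      have := h ((i, ⟨j, by omega⟩), true)
      rw [torusNext_over_of_lt hj] at this
      exact this.trans (ih _)
  have row := finRotate_iterate_eq (fun i => f (i, ⟨0, by omega⟩)) fun i => by
    have := h ((i, ⟨m - 2, by omega⟩), true)
    rw [torusNext_over_of_not_lt (by simp; omega)] at this
    exact (col _ _ _).symm.trans (this.trans (col _ _ _))
  obtain ⟨i, j⟩ := x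
  obtain ⟨i', j'⟩ := y
  exact (col i j j.2).trans ((row i i').trans (col i' j' j'.2).symm)

section

variable {X : Type*} [Quandle X] {m n : ℕ} {c : (Fin n × Fin (m - 1)) × Bool → X}
  {r : Fin n → ℕ → X}

/-- Here `r i j` is the color of the arc a_{ij}: `hlast` expresses that a_{i0} continues as
a_{i+1,m-1}, and `hact` is the crossing relation. The next lemma is its analogue for the reversed
orientation. -/
theorem torusNext_coloring (hover : ∀ i j, c ((i, j), true) = r i 0)
    (hunder : ∀ i j, c ((i, j), false) = r (finRotate n i) j.val)
    (hlast : ∀ i, r (finRotate n i) (m - 1) = r i 0)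
    (hact : ∀ i j, r (finRotate n i) j = r i 0 ◃ r i (j + 1)) (x : Fin n × Fin (m - 1)) :
    c ((torusNext m n).symm (x, true)) = c (x, true) ∧
      c (x, false) = c (x, true) ◃ c ((torusNext m n).symm (x, false)) := by
  obtain ⟨i, j⟩ := x
  have hj := j.2
  constructor
  · by_cases h0 : 0 < j.val
    · rw [torusNext_symm_over_of_pos h0, hover, hover]
    · rw [torusNext_symm_over_of_not_pos h0, hunder, Equiv.apply_symm_apply, hover,
        Nat.eq_zero_of_not_pos h0]
  · rw [hover, hunder, hact]
    congr 1
    by_cases h1 : j.val + 1 < m - 1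
    · rw [torusNext_symm_under_of_lt h1, hunder, Equiv.apply_symm_apply]
    · rw [torusNext_symm_under_of_not_lt h1, hover, ← hlast, Equiv.apply_symm_apply]
      congr 1
      omega

theorem torusNext_symm_coloring (hover : ∀ i j, c ((i, j), true) = r i 0)
    (hunder : ∀ i j, c ((i, j), false) = r i (j.val + 1))
    (hlast : ∀ i, r (finRotate n i) (m - 1) = r i 0)
    (hact : ∀ i j, r (finRotate n i) j = r i 0 ◃ r i (j + 1)) (x : Fin n × Fin (m - 1)) :
    c (torusNext m n (x, true)) = c (x, true) ∧
      c (torusNext m n (x, false)) = c (x, true) ◃ c (x, false) := by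
  obtain ⟨i, j⟩ := x
  have hj := j.2
  constructor
  · by_cases h1 : j.val + 1 < m - 1
    · rw [torusNext_over_of_lt h1, hover, hover]
    · rw [torusNext_over_of_not_lt h1, hunder, hover, ← hlast]
      congr 1
      omega
  · rw [hover, hunder, ← hact]
    by_cases h0 : 0 < j.val
    · rw [torusNext_under_of_pos h0, hunder]
      congr 1
      simp only
      omega
    · rw [torusNext_under_of_not_pos h0, hover, Nat.eq_zero_of_not_pos h0]

end

theorem finRotate_ne_self {n : ℕ} (hn : 2 ≤ n) (i : Fin n) : finRotate n i ≠ i := by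
  have : Nontrivial (Fin n) := Fin.nontrivial_iff_two_le.2 hn
  intro h
  obtain ⟨j, hj⟩ := exists_ne i
  refine hj ((finRotate_iterate_eq (fun i' => i' = i) (fun i' => ?_) i j).1 rfl)
  exact ⟨fun h' => (finRotate n).injective (h'.trans h.symm), fun h' => h' ▸ h⟩

theorem torusNext_over_crossing_ne {m n : ℕ} (hn : 2 ≤ n) (x : Fin n × Fin (m - 1)) :
    (torusNext m n (x, true)).1 ≠ x := by
  obtain ⟨i, j⟩ := x
  intro h
  by_cases h1 : j.val + 1 < m - 1
  · rw [torusNext_over_of_lt h1] at h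
    have := congrArg (fun z => z.2.val) h
    simp at this
  · rw [torusNext_over_of_not_lt h1] at h
    exact finRotate_ne_self hn i (congrArg Prod.fst h)

theorem torusNext_symm_over_crossing_ne {m n : ℕ} (hn : 2 ≤ n) (x : Fin n × Fin (m - 1)) :
    ((torusNext m n).symm (x, true)).1 ≠ x := by
  obtain ⟨i, j⟩ := x
  intro h
  by_cases h0 : 0 < j.val
  · rw [torusNext_symm_over_of_pos h0] at h
    have := congrArg (fun z => z.2.val) h
    simp only at this
    omega
  · rw [torusNext_symm_over_of_not_pos h0] at h
    have h2 : (finRotate n).symm i = i := congrArg Prod.fst h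
    exact finRotate_ne_self hn i ((Equiv.symm_apply_eq _).1 h2).symm

variable (p q : ℤ) (hp : 2 ≤ p.natAbs) (hq : 2 ≤ q.natAbs)

theorem torusDiagram_next_of_pos (h : 0 < p * q) :
    (torusDiagram p q hp hq).next = torusNext p.natAbs q.natAbs := if_pos h

theorem torusDiagram_next_of_not_pos (h : ¬ 0 < p * q) :
    (torusDiagram p q hp hq).next = (torusNext p.natAbs q.natAbs).symm := if_neg h

theorem torusDiagram_connected : (torusDiagram p q hp hq).Connected := by
  intro f hf
  refine torusNext_connected hp f fun e => ?_
  by_cases h : 0 < p * q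
  · have := hf e
    rwa [torusDiagram_next_of_pos p q hp hq h] at this
  · have := hf (torusNext p.natAbs q.natAbs e)
    rw [torusDiagram_next_of_not_pos p q hp hq h] at this
    exact (this.symm.trans (iff_of_eq (by
      exact congrArg (fun z => f z.1) (Equiv.symm_apply_apply _ e))))

variable {k l : ℕ} (Q : RegularPolygon q.natAbs l) (P : RegularPolygon p.natAbs k)

theorem isColoring_trochoidColoring
    (hlast : ∀ i, arcColor Q P (finRotate q.natAbs i) (p.natAbs - 1) = arcColor Q P i 0)
    (hact : ∀ i j, arcColor Q P (finRotate q.natAbs i) j =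
      arcColor Q P i 0 ◃ arcColor Q P i (j + 1)) :
    (torusDiagram p q hp hq).IsColoring (trochoidColoring p q hp hq Q P) := by
  intro x
  by_cases h : 0 < p * q
  · obtain ⟨h1, h2⟩ := torusNext_coloring (c := trochoidColoring p q hp hq Q P)
      (r := arcColor Q P) (fun _ _ => rfl) (fun _ _ => if_pos h) hlast hact x
    rw [torusDiagram_next_of_pos p q hp hq h]
    exact ⟨h1, fun _ => h2, fun h' => absurd h (of_decide_eq_false h')⟩
  · obtain ⟨h1, h2⟩ := torusNext_symm_coloring (c := trochoidColoring p q hp hq Q P)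
      (r := arcColor Q P) (fun _ _ => rfl) (fun _ _ => if_neg h) hlast hact x
    rw [torusDiagram_next_of_not_pos p q hp hq h]
    exact ⟨h1, fun h' => absurd (of_decide_eq_true h') h, fun _ => h2⟩

theorem hasOver_trochoidColoring
    (hC : (torusDiagram p q hp hq).IsColoring (trochoidColoring p q hp hq Q P))
    (i : Fin q.natAbs) :
    (torusDiagram p q hp hq).HasOver (trochoidColoring p q hp hq Q P) (arcColor Q P i 0) := by
  let x : Fin q.natAbs × Fin (p.natAbs - 1) := (i, ⟨0, by omega⟩)
  refine ⟨(torusDiagram p q hp hq).next.symm (x, true), x, (hC x).1,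
    Equiv.apply_symm_apply _ _, ?_⟩
  by_cases h : 0 < p * q
  · rw [torusDiagram_next_of_pos p q hp hq h]
    exact torusNext_symm_over_crossing_ne hq x
  · rw [torusDiagram_next_of_not_pos p q hp hq h]
    exact torusNext_over_crossing_ne hq x

end Torus

/-! ### Closed formulas for the trochoid. -/

section Trochoid

/-- The rotation factor `exp (2 π i k / m)` between consecutive edges of a regular polygon. -/
noncomputable def polygonFactor (m k : ℕ) : ℂ := Complex.exp (2 * Real.pi * Complex.I * k / m)

theorem RegularPolygon.vertex_eq {m k : ℕ} (R : RegularPolygon m k) (j : ℕ) :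
    R.vertex j = R.center + R.radius * polygonFactor m k ^ j := by
  rw [vertex, polygonFactor, ← Complex.exp_nat_mul]
  congr 3
  push_cast
  ring

theorem polygonFactor_pow {m : ℕ} (hm : m ≠ 0) (k : ℕ) : polygonFactor m k ^ m = 1 := by
  rw [polygonFactor, ← Complex.exp_nat_mul, Complex.exp_eq_one_iff]
  refine ⟨k, ?_⟩
  have : (m : ℂ) ≠ 0 := Nat.cast_ne_zero.2 hm
  push_cast
  field_simp

theorem polygonFactor_ne_zero (m k : ℕ) : polygonFactor m k ≠ 0 := Complex.exp_ne_zero _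

theorem exp_trochoidAngle {m n : ℕ} (hm : m ≠ 0) (hn : n ≠ 0) (k l : ℕ) :
    Complex.exp (trochoidAngle m k n l * Complex.I) * polygonFactor m k = polygonFactor n l := by
  rw [polygonFactor, polygonFactor, ← Complex.exp_add, trochoidAngle]
  have : (m : ℂ) ≠ 0 := Nat.cast_ne_zero.2 hm
  have : (n : ℂ) ≠ 0 := Nat.cast_ne_zero.2 hn
  congr 1
  push_cast
  field_simp
  ring

variable {m k n l : ℕ} {Q : RegularPolygon n l} {P : RegularPolygon m k}

/-- With κ and λ the factors of the two polygons, ζκ = λ. Because the polygons share an edge,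
passing from P_i to P_{i+1} and advancing the vertex index by one amounts to a rotation by λ about
the centre of `Q`. -/
theorem trochoid_eq (hm : m ≠ 0) (hn : n ≠ 0) (h₀ : P.vertex 0 = Q.vertex 0)
    (h₁ : P.vertex 1 = Q.vertex 1) (i j : ℕ) :
    trochoid Q P i (i + j) = Q.center + polygonFactor n l ^ i *
      (Q.radius - P.radius + P.radius * polygonFactor m k ^ j) := by
  simp only [RegularPolygon.vertex_eq, pow_zero, pow_one, mul_one] at h₀ h₁
  induction i generalizing j with
  | zero =>
    rw [trochoid, zero_add, RegularPolygon.vertex_eq]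
    linear_combination h₀
  | succ i ih =>
    rw [trochoid, show i + 1 + j = i + (j + 1) by ring, ih, RegularPolygon.vertex_eq,
      ← exp_trochoidAngle hm hn k l]
    rw [← exp_trochoidAngle hm hn k l] at h₁
    generalize Complex.exp (trochoidAngle m k n l * Complex.I) = ζ at *
    generalize polygonFactor m k = κ at *
    linear_combination (ζ * κ) ^ i * ζ * (h₁ - h₀)

theorem arcColor_center (hm : m ≠ 0) (hn : n ≠ 0) (h₀ : P.vertex 0 = Q.vertex 0)
    (h₁ : P.vertex 1 = Q.vertex 1) (i : Fin n) (j : ℕ) :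
    (arcColor Q P i j).center = Q.center + polygonFactor n l ^ i.val *
      (Q.radius - P.radius + P.radius * polygonFactor m k ^ (j + 1)) := by
  rw [← trochoid_eq hm hn h₀ h₁]
  rfl

theorem arcColor_finRotate_center (hm : m ≠ 0) (hn : n ≠ 0) (h₀ : P.vertex 0 = Q.vertex 0)
    (h₁ : P.vertex 1 = Q.vertex 1) (i : Fin n) (j : ℕ) :
    (arcColor Q P (finRotate n i) j).center = Q.center + polygonFactor n l ^ (i.val + 1) *
      (Q.radius - P.radius + P.radius * polygonFactor m k ^ (j + 1)) := by
  rw [arcColor_center hm hn h₀ h₁]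
  congr 2
  obtain ⟨n, rfl⟩ : ∃ n', n = n' + 1 := ⟨n - 1, by omega⟩
  rcases Nat.lt_or_ge i.val n with h | h
  · rw [coe_finRotate_of_ne_last (Fin.ne_of_lt h)]
  · obtain rfl : i = Fin.last n := Fin.ext (le_antisymm (Nat.le_of_lt_succ i.2) h)
    rw [finRotate_last, Fin.val_last, polygonFactor_pow hn]
    rfl

theorem arcColor_finRotate_last (hm : m ≠ 0) (hn : n ≠ 0) (h₀ : P.vertex 0 = Q.vertex 0)
    (h₁ : P.vertex 1 = Q.vertex 1) (i : Fin n) :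
    arcColor Q P (finRotate n i) (m - 1) = arcColor Q P i 0 := by
  refine RotE2.ext ?_ rfl
  rw [arcColor_finRotate_center hm hn h₀ h₁, arcColor_center hm hn h₀ h₁,
    Nat.sub_add_cancel (Nat.pos_of_ne_zero hm), polygonFactor_pow hm]
  simp only [RegularPolygon.vertex_eq, pow_zero, pow_one, mul_one] at h₀ h₁
  linear_combination polygonFactor n l ^ i.val * (h₀ - h₁)

theorem arcColor_finRotate (hm : m ≠ 0) (hn : n ≠ 0) (h₀ : P.vertex 0 = Q.vertex 0)
    (h₁ : P.vertex 1 = Q.vertex 1) (i : Fin n) (j : ℕ) :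
    arcColor Q P (finRotate n i) j = arcColor Q P i 0 ◃ arcColor Q P i (j + 1) := by
  refine RotE2.ext ?_ rfl
  change _ = ((arcColor Q P i (j + 1)).center - (arcColor Q P i 0).center) *
    (Circle.exp (trochoidAngle m k n l) : ℂ) + (arcColor Q P i 0).center
  rw [Circle.coe_exp]
  rw [arcColor_finRotate_center hm hn h₀ h₁, arcColor_center hm hn h₀ h₁,
    arcColor_center hm hn h₀ h₁]
  simp only [RegularPolygon.vertex_eq, pow_zero, pow_one, mul_one] at h₀ h₁
  rw [← exp_trochoidAngle hm hn k l]
  rw [← exp_trochoidAngle hm hn k l] at h₁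
  generalize Complex.exp (trochoidAngle m k n l * Complex.I) = ζ at *
  generalize polygonFactor m k = κ at *
  linear_combination (ζ * κ) ^ i.val * (h₀ - h₁)

end Trochoid

/-! ### Cyclotomic integers: elements of absolute value 1, and the orbit of two rotations. -/

section CyclotomicIntegers

open Polynomial in
-- Both roots have the minimal polynomial Φ_N over ℤ, so integral relations transfer between them.
theorem IsPrimitiveRoot.aeval_eq_zero_of_aeval_eq_zero {K L : Type*} [Field K] [CharZero K]
    [Field L] [CharZero L] {N : ℕ} (hN : 0 < N) {ζ : K} {μ : L} (hζ : IsPrimitiveRoot ζ N)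
    (hμ : IsPrimitiveRoot μ N) {f : ℤ[X]} (hf : aeval ζ f = 0) : aeval μ f = 0 := by
  have h := minpoly.isIntegrallyClosed_dvd (hζ.isIntegral hN) hf
  rw [← cyclotomic_eq_minpoly hζ hN, cyclotomic_eq_minpoly hμ hN] at h
  obtain ⟨g, rfl⟩ := h
  rw [map_mul, minpoly.aeval, zero_mul]

theorem aeval_conj_int (f : Polynomial ℤ) (z : ℂ) :
    Polynomial.aeval ((starRingEnd ℂ) z) f = (starRingEnd ℂ) (Polynomial.aeval z f) :=
  Polynomial.aeval_algHom_apply (starRingEnd ℂ).toIntAlgHom z f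

theorem IsPrimitiveRoot.pow_pred_eq_conj {N : ℕ} (hN : 0 < N) {ζ : ℂ}
    (hζ : IsPrimitiveRoot ζ N) : ζ ^ (N - 1) = (starRingEnd ℂ) ζ := by
  rw [← Complex.inv_eq_conj (hζ.norm'_eq_one hN.ne')]
  refine eq_inv_of_mul_eq_one_left ?_
  rw [← pow_succ, Nat.sub_add_cancel hN, hζ.pow_eq_one]

open Polynomial in
-- As complex conjugation is ζ ↦ ζ^{N-1}, having absolute value 1 is the integral relation
-- g(ζ)g(ζ^{N-1}) = 1, which passes to all conjugates. Kronecker's theorem then yields a root of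
-- unity of the cyclotomic field, whose torsion order is known.
theorem IsPrimitiveRoot.aeval_pow_eq_one_of_norm_eq_one {N : ℕ} (hN : 0 < N) {ζ : ℂ}
    (hζ : IsPrimitiveRoot ζ N) {g : ℤ[X]} (hnorm : ‖aeval ζ g‖ = 1) {K : Type*} [Field K]
    [NumberField K] [IsCyclotomicExtension {N} ℚ K] {z : K} (hz : IsPrimitiveRoot z N) :
    aeval ζ g ^ (if Even N then N else 2 * N) = 1 := by
  have hval (μ : ℂ) (hμ : IsPrimitiveRoot μ N) :
      aeval μ (g * g.comp (X ^ (N - 1)) - 1) = (‖aeval μ g‖ ^ 2 - 1 : ℝ) := by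
    simp only [map_sub, map_mul, aeval_comp, map_pow, aeval_X, map_one, hμ.pow_pred_eq_conj hN,
      aeval_conj_int, Complex.mul_conj, Complex.normSq_eq_norm_sq]
    push_cast
    ring
  have : NeZero N := ⟨hN.ne'⟩
  have hint : IsIntegral ℤ (aeval z g) :=
    adjoin_le_integralClosure (hz.isIntegral hN) (aeval_mem_adjoin_singleton ℤ z)
  have hemb (φ : K →+* ℂ) : ‖φ (aeval z g)‖ = 1 := by
    have hφ : IsPrimitiveRoot (φ z) N := hz.map_of_injective φ.injective
    have h1 : φ (aeval z g) = aeval (φ z) g := (aeval_algHom_apply φ.toIntAlgHom z g).symm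
    have h2 := hζ.aeval_eq_zero_of_aeval_eq_zero hN hφ (f := g * g.comp (X ^ (N - 1)) - 1)
      (by rw [hval ζ hζ, hnorm]; simp)
    rw [hval _ hφ, Complex.ofReal_eq_zero, sub_eq_zero] at h2
    rw [h1]
    exact (pow_eq_one_iff_of_nonneg (norm_nonneg _) two_ne_zero).1 h2
  obtain ⟨n, hn, hpow⟩ := NumberField.Embeddings.pow_eq_one_of_norm_eq_one K ℂ hint hemb
  have : NeZero (orderOf (aeval z g)) :=
    ⟨(orderOf_pos_iff.2 (isOfFinOrder_iff_pow_eq_one.2 ⟨n, hn, hpow⟩)).ne'⟩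
  have hdvd := NumberField.Units.dvd_torsionOrder_of_isPrimitiveRoot
    (IsPrimitiveRoot.orderOf (aeval z g))
  rw [IsCyclotomicExtension.Rat.torsionOrder_eq (n := N), orderOf_dvd_iff_pow_eq_one] at hdvd
  have h3 := hz.aeval_eq_zero_of_aeval_eq_zero hN hζ (f := g ^ (if Even N then N else 2 * N) - 1)
    (by rw [map_sub, map_pow, map_one, hdvd, sub_self])
  rwa [map_sub, map_pow, map_one, sub_eq_zero] at h3

/-- An element of `ℤ[ζ]` on the unit circle is a root of unity of the expected order. -/
theorem IsPrimitiveRoot.pow_eq_one_of_norm_eq_one {N : ℕ} (hN : 0 < N) {ζ a : ℂ}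
    (hζ : IsPrimitiveRoot ζ N) (ha : a ∈ Algebra.adjoin ℤ {ζ}) (hnorm : ‖a‖ = 1) :
    a ^ (if Even N then N else 2 * N) = 1 := by
  rw [Algebra.adjoin_singleton_eq_range_aeval] at ha
  obtain ⟨g, rfl⟩ := ha
  have : NeZero N := ⟨hN.ne'⟩
  have hcyc := CyclotomicField.isCyclotomicExtension N ℚ
  -- The two ℚ-algebra structures on the field agree propositionally; the number field lemma uses
  -- the second.
  rw [Subsingleton.elim (CyclotomicField.algebra N ℚ) DivisionRing.toRatAlgebra] at hcyc
  exact hζ.aeval_pow_eq_one_of_norm_eq_one hN hnorm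
    (IsCyclotomicExtension.zeta_spec N ℚ (CyclotomicField N ℚ))

open Polynomial in
/-- If `N` is not a prime power, then `1 - ζ` is a unit of `ℤ[ζ]`. -/
theorem IsPrimitiveRoot.exists_mul_one_sub_eq_one {N : ℕ} (hN : 0 < N) {ζ : ℂ}
    (hζ : IsPrimitiveRoot ζ N) (hpow : ∀ {r : ℕ}, r.Prime → ∀ k : ℕ, r ^ k ≠ N) :
    ∃ s ∈ Algebra.adjoin ℤ {ζ}, s * (1 - ζ) = 1 := by
  -- As Φ_N(1) = 1, Φ_N - 1 = (X - 1)g; evaluation at ζ exhibits g(ζ) as the inverse of 1 - ζ.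
  obtain ⟨g, hg⟩ := X_sub_C_dvd_sub_C_eval (a := (1 : ℤ)) (p := cyclotomic N ℤ)
  rw [eval_one_cyclotomic_not_prime_pow hpow] at hg
  refine ⟨aeval ζ g, aeval_mem_adjoin_singleton ℤ ζ, ?_⟩
  have h := congrArg (aeval ζ) hg
  rw [cyclotomic_eq_minpoly hζ hN] at h
  simp only [map_sub, minpoly.aeval, map_mul, aeval_X, map_one, zero_sub] at h
  linear_combination h

theorem Nat.Coprime.pow_ne_mul {a b : ℕ} (hab : a.Coprime b) (ha : 2 ≤ a) (hb : 2 ≤ b)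
    {r : ℕ} (hr : r.Prime) (k : ℕ) : r ^ k ≠ a * b := by
  intro h
  have key {c : ℕ} (hc : 2 ≤ c) (hd : c ∣ a * b) : r ∣ c := by
    rw [← h] at hd
    obtain ⟨i, -, rfl⟩ := (Nat.dvd_prime_pow hr).1 hd
    exact dvd_pow_self r (by rintro rfl; simp at hc)
  exact hr.one_lt.ne' (Nat.eq_one_of_dvd_coprimes hab (key ha (_root_.dvd_mul_right _ _))
    (key hb (_root_.dvd_mul_left _ _)))

/-- If `N` is not a prime power, the orbit of `0` under the rotations about `0` and `1` with
a factor of order `N` contains all cyclotomic integers. -/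
theorem IsPrimitiveRoot.adjoin_subset_of_rotations {N : ℕ} (hN : 0 < N) {ζ : ℂ}
    (hζ : IsPrimitiveRoot ζ N) (hpow : ∀ {r : ℕ}, r.Prime → ∀ k : ℕ, r ^ k ≠ N)
    {T : Set ℂ} (h0 : 0 ∈ T) (hrot : ∀ t ∈ T, t * ζ ∈ T) (hrot' : ∀ t ∈ T, (t - 1) * ζ + 1 ∈ T) :
    (Algebra.adjoin ℤ {ζ} : Set ℂ) ⊆ T := by
  have hinv : ζ ^ (N - 1) * ζ = 1 := by
    rw [← pow_succ, Nat.sub_add_cancel hN, hζ.pow_eq_one]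
  have hrotn (n : ℕ) (t : ℂ) (ht : t ∈ T) : t * ζ ^ n ∈ T := by
    induction n with
    | zero => simpa using ht
    | succ n ih =>
      rw [pow_succ, ← mul_assoc]
      exact hrot _ ih
  have hrotn' (n : ℕ) (t : ℂ) (ht : t ∈ T) : (t - 1) * ζ ^ n + 1 ∈ T := by
    induction n with
    | zero => simpa using ht
    | succ n ih =>
      rw [pow_succ, ← mul_assoc]
      simpa using hrot' _ ih
  -- The translations that, together with their inverses, preserve `T`.
  let L : AddSubgroup ℂ :=
    { carrier := {c | ∀ t ∈ T, t + c ∈ T ∧ t - c ∈ T}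
      zero_mem' := fun t ht => by simpa using ht
      add_mem' := fun {c d} hc hd t ht => by
        rw [← add_assoc, ← sub_sub]
        exact ⟨(hd _ (hc t ht).1).1, (hd _ (hc t ht).2).2⟩
      neg_mem' := fun {c} hc t ht => by
        rw [sub_neg_eq_add, ← sub_eq_add_neg]
        exact (hc t ht).symm }
  -- Rotate backwards about one centre and forwards about the other; the backward rotation is the
  -- (N-1)-st power.
  have hL1 : 1 - ζ ∈ L := by
    intro t ht
    have h1 := hrot' _ (hrotn (N - 1) t ht)
    have h2 := hrot _ (hrotn' (N - 1) t ht)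
    rw [show (t * ζ ^ (N - 1) - 1) * ζ + 1 = t + (1 - ζ) by linear_combination t * hinv] at h1
    rw [show ((t - 1) * ζ ^ (N - 1) + 1) * ζ = t - (1 - ζ) by
      linear_combination (t - 1) * hinv] at h2
    exact ⟨h1, h2⟩
  -- Conjugating a translation by the rotation about 0 multiplies its vector by ζ, so `L` is a
  -- ℤ[ζ]-module.
  have hLmul (a : ℂ) (ha : a ∈ Algebra.adjoin ℤ {ζ}) : ∀ c ∈ L, a * c ∈ L := by
    induction ha using Algebra.adjoin_induction with
    | mem x hx =>
      obtain rfl := hx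
      intro c hc t ht
      obtain ⟨h1, h2⟩ := hc _ (hrotn (N - 1) t ht)
      have h1 := hrot _ h1
      have h2 := hrot _ h2
      rw [show (t * x ^ (N - 1) + c) * x = t + x * c by linear_combination t * hinv] at h1
      rw [show (t * x ^ (N - 1) - c) * x = t - x * c by linear_combination t * hinv] at h2
      exact ⟨h1, h2⟩
    | algebraMap r =>
      intro c hc
      simpa using L.zsmul_mem hc r
    | add x y _ _ hx hy =>
      intro c hc
      rw [add_mul]
      exact L.add_mem (hx c hc) (hy c hc)
    | mul x y _ _ hx hy =>
      intro c hc
      rw [mul_assoc]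
      exact hx _ (hy c hc)
  obtain ⟨s, hs, hs1⟩ := hζ.exists_mul_one_sub_eq_one hN hpow
  intro a ha
  have h1 := hLmul a ha _ (hLmul s hs _ hL1)
  rw [hs1, mul_one] at h1
  simpa using (h1 0 h0).1

end CyclotomicIntegers

/-! ### Orders of the rotation factors, repeated actions, and the lattice of colors. -/

section Factors

theorem polygonFactor_isPrimitiveRoot {m : ℕ} (hm : m ≠ 0) (k : ℕ) :
    IsPrimitiveRoot (polygonFactor m k) (m / m.gcd k) := by
  have hg : 0 < m.gcd k := Nat.gcd_pos_of_pos_left _ (Nat.pos_of_ne_zero hm)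
  have h := Complex.isPrimitiveRoot_exp_of_coprime (k / m.gcd k) (m / m.gcd k)
    (Nat.div_pos (Nat.gcd_le_left _ (Nat.pos_of_ne_zero hm)) hg).ne'
    (Nat.coprime_div_gcd_div_gcd hg).symm
  convert h using 1
  have : ((m.gcd k : ℕ) : ℂ) ≠ 0 := Nat.cast_ne_zero.2 hg.ne'
  rw [polygonFactor, Nat.cast_div (Nat.gcd_dvd_right m k) this,
    Nat.cast_div (Nat.gcd_dvd_left m k) this]
  have : (m : ℂ) ≠ 0 := Nat.cast_ne_zero.2 hm
  congr 1
  field_simp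

theorem two_le_div_gcd {m k : ℕ} (hk : 1 ≤ k) (hk' : k < m) : 2 ≤ m / m.gcd k := by
  have hg : 0 < m.gcd k := Nat.gcd_pos_of_pos_right _ hk
  have hle : m.gcd k ≤ k := Nat.gcd_le_right _ hk
  have hmul := Nat.div_mul_cancel (Nat.gcd_dvd_left m k)
  by_contra hcon
  generalize m / m.gcd k = d at *
  interval_cases d <;> omega

end Factors

section Enlarges

variable {X : Type*} [Quandle X]

open Diagram in
theorem Diagram.Enlarges.trans {A B C : ColoredDiagram X} (h : Enlarges A B)
    (h' : Enlarges B C) : Enlarges A C :=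
  ⟨.trans _ _ _ h.requiv h'.requiv, h'.isColoring, h'.connected ∘ h.connected,
    fun c hc => h'.hasOver c (h.hasOver c hc)⟩

open Diagram in
/-- The colors that can be produced from `A` by pushing fingers. -/
def fingerColors (A : ColoredDiagram X) : Set X :=
  {c | ∃ B, Enlarges A B ∧ ∃ e, B.2 e = c}

open Diagram in
theorem color_mem_fingerColors {A : ColoredDiagram X} (hA : A.1.IsColoring A.2) (e : A.1.Edge) :
    A.2 e ∈ fingerColors A := ⟨A, ⟨.refl _, hA, id, fun _ => id⟩, e, rfl⟩

open Diagram in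
-- Over-colors persist in every enlargement, so those of the initial diagram can act any number of
-- times.
theorem act_mem_fingerColors {A : ColoredDiagram X} (hA : A.1.Connected) {c x : X}
    (hc : A.1.HasOver A.2 c) (hx : x ∈ fingerColors A) : c ◃ x ∈ fingerColors A := by
  obtain ⟨B, hB, e, rfl⟩ := hx
  obtain ⟨B', hB', h⟩ := exists_act_color hB.isColoring (hB.connected hA) (hB.hasOver c hc) e
  exact ⟨B', hB.trans hB', h⟩

end Enlarges

section Lattice

variable {m k n l : ℕ}

/-- The rotation factor of the trochoid. -/
noncomputable def trochoidFactor (m k n l : ℕ) : ℂ :=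
  Complex.exp (trochoidAngle m k n l * Complex.I)

theorem coe_circleExp_trochoidAngle :
    (Circle.exp (trochoidAngle m k n l) : ℂ) = trochoidFactor m k n l := Circle.coe_exp _

/-- ζ = κ⁻¹λ, and the orders of κ and λ are coprime. -/
theorem trochoidFactor_isPrimitiveRoot (hm : m ≠ 0) (hn : n ≠ 0) (hmn : m.Coprime n) :
    IsPrimitiveRoot (trochoidFactor m k n l) (m / m.gcd k * (n / n.gcd l)) := by
  have hκ := polygonFactor_isPrimitiveRoot hm k
  have hl := polygonFactor_isPrimitiveRoot hn l
  have hcop : (m / m.gcd k).Coprime (n / n.gcd l) :=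
    (hmn.coprime_div_left (Nat.gcd_dvd_left m k)).coprime_div_right (Nat.gcd_dvd_left n l)
  have h : trochoidFactor m k n l = (polygonFactor m k)⁻¹ * polygonFactor n l := by
    rw [← exp_trochoidAngle hm hn k l, trochoidFactor]
    field_simp [polygonFactor_ne_zero m k]
  have hi := hκ.inv
  rw [h, hi.eq_orderOf, hl.eq_orderOf,
    ← (Commute.all _ _).orderOf_mul_eq_mul_orderOf_of_coprime
      (by rwa [← hi.eq_orderOf, ← hl.eq_orderOf])]
  exact IsPrimitiveRoot.orderOf _

theorem polygonFactor_mem_adjoin (hm : m ≠ 0) (hn : n ≠ 0) (hmn : m.Coprime n) :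
    polygonFactor m k ∈ Algebra.adjoin ℤ {trochoidFactor m k n l} ∧
      polygonFactor n l ∈ Algebra.adjoin ℤ {trochoidFactor m k n l} := by
  have hζ := trochoidFactor_isPrimitiveRoot (k := k) (l := l) hm hn hmn
  have hN : m / m.gcd k * (n / n.gcd l) ≠ 0 := Nat.mul_ne_zero
    (Nat.div_pos (Nat.gcd_le_left _ (by omega)) (Nat.gcd_pos_of_pos_left _ (by omega))).ne'
    (Nat.div_pos (Nat.gcd_le_left _ (by omega)) (Nat.gcd_pos_of_pos_left _ (by omega))).ne'
  have : NeZero (m / m.gcd k * (n / n.gcd l)) := ⟨hN⟩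
  have key (x : ℂ) (hx : x ^ (m / m.gcd k * (n / n.gcd l)) = 1) :
      x ∈ Algebra.adjoin ℤ {trochoidFactor m k n l} := by
    obtain ⟨i, -, rfl⟩ := hζ.eq_pow_of_pow_eq_one hx
    exact pow_mem (Algebra.self_mem_adjoin_singleton ℤ _) i
  constructor
  · apply key
    rw [pow_mul, (polygonFactor_isPrimitiveRoot hm k).pow_eq_one, one_pow]
  · apply key
    rw [mul_comm, pow_mul, (polygonFactor_isPrimitiveRoot hn l).pow_eq_one, one_pow]

variable {Q : RegularPolygon n l} {P : RegularPolygon m k}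

/-- The rotations with the factor of the trochoid about the points of a translated and rotated
copy of `ℤ[ζ]`. -/
def latticeColors (m k n l : ℕ) (w u : ℂ) : Set RotE2 :=
  {x | x.factor = Circle.exp (trochoidAngle m k n l) ∧
    ∃ a ∈ Algebra.adjoin ℤ {trochoidFactor m k n l}, x.center = w + u * a}

theorem quandleClosed_latticeColors (hm : m ≠ 0) (hn : n ≠ 0) (hmn : m.Coprime n) (w u : ℂ)
    (hN : 0 < m / m.gcd k * (n / n.gcd l)) :
    Diagram.QuandleClosed (latticeColors m k n l w u) := by
  have hζ := trochoidFactor_isPrimitiveRoot (k := k) (l := l) hm hn hmn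
  have hmem := Algebra.self_mem_adjoin_singleton ℤ (trochoidFactor m k n l)
  have hinv : (trochoidFactor m k n l)⁻¹ ∈ Algebra.adjoin ℤ {trochoidFactor m k n l} := by
    rw [Complex.inv_eq_conj (hζ.norm'_eq_one hN.ne'), ← hζ.pow_pred_eq_conj hN]
    exact pow_mem hmem _
  constructor
  · rintro y x ⟨hy, b, hb, hyb⟩ ⟨hx, a, ha, hxa⟩
    refine ⟨hx, (a - b) * trochoidFactor m k n l + b, add_mem (mul_mem (sub_mem ha hb) hmem) hb, ?_⟩
    change (x.center - y.center) * (y.factor : ℂ) + y.center = _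
    rw [hy, coe_circleExp_trochoidAngle, hxa, hyb]
    ring
  · rintro y x ⟨hy, b, hb, hyb⟩ ⟨hx, a, ha, hxa⟩
    refine ⟨hx, (a - b) * (trochoidFactor m k n l)⁻¹ + b,
      add_mem (mul_mem (sub_mem ha hb) hinv) hb, ?_⟩
    change (x.center - y.center) * (y.factor : ℂ)⁻¹ + y.center = _
    rw [hy, coe_circleExp_trochoidAngle, hxa, hyb]
    ring

theorem arcColor_mem_latticeColors (hm : m ≠ 0) (hn : n ≠ 0) (hmn : m.Coprime n)
    (h₀ : P.vertex 0 = Q.vertex 0) (h₁ : P.vertex 1 = Q.vertex 1) (i : Fin n) (j : ℕ) :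
    arcColor Q P i j ∈ latticeColors m k n l (P.vertex 0) (P.vertex 1 - P.vertex 0) := by
  obtain ⟨hκ, hl⟩ := polygonFactor_mem_adjoin (k := k) (l := l) hm hn hmn
  -- Walk `i` edges along `Q` from its vertex 0 to its vertex `i`, which is w_{ii}, then `j + 1`
  -- edges along P_i; each edge is u times a product of powers of the factors.
  refine ⟨rfl, ∑ t ∈ Finset.range i.val, polygonFactor n l ^ t + polygonFactor n l ^ i.val *
    ∑ t ∈ Finset.range (j + 1), polygonFactor m k ^ t,
    add_mem (sum_mem fun t _ => pow_mem hl t) (mul_mem (pow_mem hl _)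
      (sum_mem fun t _ => pow_mem hκ t)), ?_⟩
  rw [arcColor_center hm hn h₀ h₁]
  simp only [RegularPolygon.vertex_eq, pow_zero, pow_one, mul_one] at h₀ h₁ ⊢
  have g1 := mul_geom_sum (polygonFactor n l) i.val
  have g2 := mul_geom_sum (polygonFactor m k) (j + 1)
  generalize ∑ t ∈ Finset.range i.val, polygonFactor n l ^ t = s1 at *
  generalize ∑ t ∈ Finset.range (j + 1), polygonFactor m k ^ t = s2 at *
  linear_combination (s1 - 1) * h₀ - s1 * h₁ - Q.radius * g1 -
    P.radius * polygonFactor n l ^ i.val * g2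

end Lattice

/-! ### The reachable points, and those on a unit circle. -/

section ReachablePoints

variable {p q : ℤ} {hp : 2 ≤ p.natAbs} {hq : 2 ≤ q.natAbs} {k l : ℕ}
  {Q : RegularPolygon q.natAbs l} {P : RegularPolygon p.natAbs k}

theorem trochoidColoring_eq_arcColor (e : (torusDiagram p q hp hq).Edge) :
    ∃ i j, trochoidColoring p q hp hq Q P e = arcColor Q P i j := by
  obtain ⟨⟨i, j⟩, _ | _⟩ := e
  · by_cases h : 0 < p * q
    · exact ⟨_, _, if_pos h⟩
    · exact ⟨_, _, if_neg h⟩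
  · exact ⟨i, 0, rfl⟩

/-- The reachable points form a translated and rotated copy of the ring `ℤ[ζ]`. -/
theorem reachablePoints_eq (hpq : IsCoprime p q) (hk : 1 ≤ k) (hk' : k < p.natAbs) (hl : 1 ≤ l)
    (hl' : l < q.natAbs) (h₀ : P.vertex 0 = Q.vertex 0) (h₁ : P.vertex 1 = Q.vertex 1) :
    reachablePoints p q hp hq Q P =
      {w | ∃ a ∈ Algebra.adjoin ℤ {trochoidFactor p.natAbs k q.natAbs l},
        w = P.vertex 0 + (P.vertex 1 - P.vertex 0) * a} := by
  have hm : p.natAbs ≠ 0 := by omega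
  have hn : q.natAbs ≠ 0 := by omega
  have hmn : p.natAbs.Coprime q.natAbs := Int.isCoprime_iff_gcd_eq_one.1 hpq
  have hp2 := two_le_div_gcd hk hk'
  have hq2 := two_le_div_gcd hl hl'
  have hN : 0 < p.natAbs / p.natAbs.gcd k * (q.natAbs / q.natAbs.gcd l) := by positivity
  have hcop : (p.natAbs / p.natAbs.gcd k).Coprime (q.natAbs / q.natAbs.gcd l) :=
    (hmn.coprime_div_left (Nat.gcd_dvd_left _ k)).coprime_div_right (Nat.gcd_dvd_left _ l)
  have hζ := trochoidFactor_isPrimitiveRoot (k := k) (l := l) hm hn hmn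
  have hC := isColoring_trochoidColoring p q hp hq Q P (arcColor_finRotate_last hm hn h₀ h₁)
    (arcColor_finRotate hm hn h₀ h₁)
  ext w
  constructor
  · rintro ⟨D, C, hDC, e, rfl⟩
    have hS := quandleClosed_latticeColors (k := k) (l := l) hm hn hmn (P.vertex 0)
      (P.vertex 1 - P.vertex 0) hN
    refine ((hDC.mem_iff hS).1 (fun e => ?_) e).2
    obtain ⟨i, j, h⟩ := trochoidColoring_eq_arcColor (hp := hp) (hq := hq) (Q := Q) (P := P) e
    change trochoidColoring p q hp hq Q P e ∈ _
    rw [h]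
    exact arcColor_mem_latticeColors hm hn hmn h₀ h₁ i j
  · rintro ⟨a, ha, rfl⟩
    let A : ColoredDiagram RotE2 := ⟨torusDiagram p q hp hq, trochoidColoring p q hp hq Q P⟩
    let pt (t : ℂ) : RotE2 := ⟨P.vertex 0 + (P.vertex 1 - P.vertex 0) * t,
      Circle.exp (trochoidAngle p.natAbs k q.natAbs l)⟩
    -- In the last block the over-arc is centred at the vertex of `Q` with index |q|, that is w₀₀;
    -- in block 0 it is centred at w₀₁.
    have hfirst : arcColor Q P ⟨q.natAbs - 1, by omega⟩ 0 = pt 0 := by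
      refine RotE2.ext ?_ rfl
      have hpow := polygonFactor_pow hn l
      rw [← Nat.sub_add_cancel (Nat.pos_of_ne_zero hn), pow_succ] at hpow
      rw [arcColor_center hm hn h₀ h₁]
      simp only [pt]
      simp only [RegularPolygon.vertex_eq, pow_zero, pow_one, mul_one, zero_add] at h₀ h₁ ⊢
      rw [Nat.sub_add_cancel (Nat.pos_of_ne_zero hn)] at hpow
      linear_combination polygonFactor q.natAbs l ^ (q.natAbs - 1) * (h₁ - h₀) + Q.radius * hpow - h₀
    have hsecond : arcColor Q P ⟨0, by omega⟩ 0 = pt 1 := by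
      refine RotE2.ext ?_ rfl
      rw [arcColor_center hm hn h₀ h₁]
      simp only [pt]
      simp only [RegularPolygon.vertex_eq, pow_zero, pow_one, mul_one, zero_add] at h₀ h₁ ⊢
      linear_combination -h₀
    have hover := hasOver_trochoidColoring p q hp hq Q P hC
    have hover0 := hover ⟨q.natAbs - 1, by omega⟩
    have hover1 := hover ⟨0, by omega⟩
    rw [hfirst] at hover0
    rw [hsecond] at hover1
    have hact (s t : ℂ) : pt s ◃ pt t = pt ((t - s) * trochoidFactor p.natAbs k q.natAbs l + s) := by
      refine RotE2.ext ?_ rfl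
      change ((pt t).center - (pt s).center) *
        (Circle.exp (trochoidAngle p.natAbs k q.natAbs l) : ℂ) + (pt s).center = _
      rw [coe_circleExp_trochoidAngle]
      simp only [pt]
      ring
    have hconn := torusDiagram_connected p q hp hq
    have hsub := hζ.adjoin_subset_of_rotations hN (hcop.pow_ne_mul hp2 hq2)
      (T := {t | pt t ∈ fingerColors A})
      (by
        obtain ⟨e, -, he, -⟩ := hover0
        have h := color_mem_fingerColors (A := A) hC e
        rwa [show A.2 e = pt 0 from he] at h)
      (fun t ht => by
        have h := act_mem_fingerColors (A := A) hconn hover0 ht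
        rw [hact] at h
        simpa using h)
      (fun t ht => by
        have h := act_mem_fingerColors (A := A) hconn hover1 ht
        rwa [hact] at h)
    obtain ⟨⟨D, C⟩, hB, e, he⟩ := hsub ha
    exact ⟨D, C, hB.requiv, e, congrArg RotE2.center he⟩

end ReachablePoints

theorem unitVector_eq {w₀ w₁ : ℂ} (h : ‖w₁ - w₀‖ = 1) {α : ℕ} (hα : α ≠ 0) (σ : ℕ) :
    unitVector w₀ w₁ α σ =
      (w₁ - w₀) * Complex.exp (2 * Real.pi * Complex.I / (2 * α : ℕ)) ^ σ := by
  have h1 := Complex.norm_mul_exp_arg_mul_I (w₁ - w₀)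
  rw [h, Complex.ofReal_one, one_mul] at h1
  conv_rhs => rw [← h1]
  rw [← Complex.exp_nat_mul, ← Complex.exp_add, unitVector, Complex.ofReal_cos,
    Complex.ofReal_sin, mul_comm Complex.I, ← Complex.exp_mul_I]
  have : (α : ℂ) ≠ 0 := Nat.cast_ne_zero.2 hα
  congr 1
  push_cast
  field_simp

theorem two_mul_alphaNumber (p q : ℤ) (k l : ℕ) :
    let N := p.natAbs / p.natAbs.gcd k * (q.natAbs / q.natAbs.gcd l)
    2 * alphaNumber p q k l = if Even N then N else 2 * N := by
  simp only [alphaNumber]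
  split_ifs with h
  · exact Nat.mul_div_cancel' h.two_dvd
  · rfl

/-- For odd N the 2N-th roots of unity are the N-th ones and their negatives; the N-th ones are
powers of ζ. -/
theorem IsPrimitiveRoot.mem_adjoin_of_pow_eq_one {N : ℕ} (hN : 0 < N) {ζ x : ℂ}
    (hζ : IsPrimitiveRoot ζ N) (hx : x ^ (if Even N then N else 2 * N) = 1) :
    x ∈ Algebra.adjoin ℤ {ζ} := by
  have : NeZero N := ⟨hN.ne'⟩
  have key (y : ℂ) (hy : y ^ N = 1) : y ∈ Algebra.adjoin ℤ {ζ} := by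
    obtain ⟨i, -, rfl⟩ := hζ.eq_pow_of_pow_eq_one hy
    exact pow_mem (Algebra.self_mem_adjoin_singleton ℤ _) i
  split_ifs at hx with h
  · exact key x hx
  · rw [mul_comm, pow_mul] at hx
    rcases sq_eq_sq_iff_eq_or_eq_neg.1 (hx.trans (one_pow 2).symm) with hx | hx
    · exact key x hx
    · have h1 := key (-x) (by rw [(Nat.not_even_iff_odd.1 h).neg_pow, hx, neg_neg])
      simpa using neg_mem h1

theorem corollary6p7 (p q : ℤ) (hp : 2 ≤ p.natAbs) (hq : 2 ≤ q.natAbs) (hpq : IsCoprime p q)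
    (k l : ℕ) (hk : 1 ≤ k) (hk' : k < p.natAbs) (hl : 1 ≤ l) (hl' : l < q.natAbs)
    (Q : RegularPolygon q.natAbs l) (P : RegularPolygon p.natAbs k)
    (h₀ : P.vertex 0 = Q.vertex 0) (h₁ : P.vertex 1 = Q.vertex 1)
    (hside : dist (Q.vertex 0) (Q.vertex 1) = 1)
    (w : ℂ) (hw : w ∈ reachablePoints p q hp hq Q P) :
    reachablePoints p q hp hq Q P ∩ Metric.sphere w 1 =
        {z | ∃ σ < 2 * alphaNumber p q k l,
          z = w + unitVector (P.vertex 0) (P.vertex 1) (alphaNumber p q k l) σ} ∧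
      (reachablePoints p q hp hq Q P ∩ Metric.sphere w 1).ncard = 2 * alphaNumber p q k l := by
  have hu : ‖P.vertex 1 - P.vertex 0‖ = 1 := by
    rw [← dist_eq_norm, dist_comm, h₀, h₁, hside]
  have hp2 := two_le_div_gcd hk hk'
  have hq2 := two_le_div_gcd hl hl'
  have hN : 0 < p.natAbs / p.natAbs.gcd k * (q.natAbs / q.natAbs.gcd l) := by positivity
  have hζ := trochoidFactor_isPrimitiveRoot (k := k) (l := l) (by omega) (by omega)
    (Int.isCoprime_iff_gcd_eq_one.1 hpq)
  have h2α := two_mul_alphaNumber p q k l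
  have hα : alphaNumber p q k l ≠ 0 := by
    intro h
    rw [h] at h2α
    dsimp only at h2α
    split_ifs at h2α <;> omega
  have hμ := Complex.isPrimitiveRoot_exp (2 * alphaNumber p q k l) (by omega)
  have : NeZero (2 * alphaNumber p q k l) := ⟨by omega⟩
  rw [reachablePoints_eq hpq hk hk' hl hl' h₀ h₁] at hw ⊢
  simp only [unitVector_eq hu hα]
  generalize P.vertex 1 - P.vertex 0 = u at *
  have hu0 : u ≠ 0 := norm_ne_zero_iff.1 (by rw [hu]; exact one_ne_zero)
  obtain ⟨a, ha, rfl⟩ := hw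
  set μ := Complex.exp (2 * Real.pi * Complex.I / (2 * alphaNumber p q k l : ℕ))
  have heq : {w' | ∃ b ∈ Algebra.adjoin ℤ {trochoidFactor p.natAbs k q.natAbs l},
      w' = P.vertex 0 + u * b} ∩ Metric.sphere (P.vertex 0 + u * a) 1 =
      (fun σ => P.vertex 0 + u * a + u * μ ^ σ) '' Set.Iio (2 * alphaNumber p q k l) := by
    ext z
    constructor
    · rintro ⟨⟨b, hb, rfl⟩, hz⟩
      have hnorm : ‖b - a‖ = 1 := by
        rwa [mem_sphere_iff_norm, add_sub_add_left_eq_sub, ← mul_sub, norm_mul, hu, one_mul] at hz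
      -- The difference of the two lattice coordinates is a cyclotomic integer of absolute value 1,
      -- hence a 2α-th root of unity.
      have hpow := hζ.pow_eq_one_of_norm_eq_one hN (sub_mem hb ha) hnorm
      rw [← h2α] at hpow
      obtain ⟨σ, hσ, h⟩ := hμ.eq_pow_of_pow_eq_one hpow
      refine ⟨σ, hσ, ?_⟩
      simp only [h]
      ring
    · rintro ⟨σ, hσ, rfl⟩
      refine ⟨⟨a + μ ^ σ, add_mem ha (hζ.mem_adjoin_of_pow_eq_one hN ?_), by ring⟩, ?_⟩
      · rw [← h2α, ← pow_mul, mul_comm, pow_mul, hμ.pow_eq_one, one_pow]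
      · rw [mem_sphere_iff_norm, add_sub_cancel_left, norm_mul, hu, one_mul, norm_pow,
          hμ.norm'_eq_one (by omega), one_pow]
  rw [heq]
  constructor
  · ext z
    exact ⟨fun ⟨σ, hσ, h⟩ => ⟨σ, hσ, h.symm⟩, fun ⟨σ, hσ, h⟩ => ⟨σ, hσ, h.symm⟩⟩
  · rw [Set.InjOn.ncard_image, Set.ncard_eq_toFinset_card', Set.toFinset_Iio, Nat.card_Iio]
    intro σ hσ σ' hσ' h
    exact hμ.pow_inj hσ hσ' (mul_left_cancel₀ hu0 (add_left_cancel h))
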